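/- Let $E$ be the finite set of links of a wireless network, let $G_c$ be its conflict graph (a simple graph with vertex set $E$), and let $\mathcal I$ be the set of all independent sets of $G_c$, including $\emptyset$. Let $\mathcal S$ be a finite set of flows; the route of a flow $s\in\mathcal S$ is a non-empty set of links, and $l\in s$ means that link $l$ lies on it. Let $\alpha,\beta,k>0$ and let $T_s>0$ ($s\in\mathcal S$) be the round trip times. Write $[g]_z^+=\max(g,0)$ if $z\le 0$ and $[g]_z^+=g$ otherwise. Consider, for states $x=(x_s)_{s\in\mathcal S}$ with all $x_s>0$ and $r=(r_l)_{l\in E}$ with all $r_l\ge0$, the system (multi-connection TCP Reno over A-CSMA with AQM) $$n_s=kT_s,\qquad \dot x_s=\frac{x_s^2}{2n_s}\Big[\frac{2n_s^2}{T_s^2x_s^2}-\sum_{l\in s}r_l\Big]_{x_s}^+\ (s\in\mathcal S),\qquad \dot r_l=\alpha\Big[\sum_{s:\,l\in s}x_s-\sum_{i\in\mathcal I:\,l\in i}\tau_i(r)\Big]_{r_l}^+\ (l\in E),$$ $$\tau_i(r)=\frac{\exp\big(\sum_{l\in i}\beta r_l\big)}{\sum_{i'\in\mathcal I}\exp\big(\sum_{l\in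 i'}\beta r_l\big)}\qquad(i\in\mathcal I).$$ (Time-scale separation: at each instant the schedules are distributed according to the stationary distribution $\tau(r)$ of the CSMA Markov chain.) For $b>0$ let $\mathbf{MP}(b)$ be the problem $$\max_{x\ge0,\ \tau\ge0}\ \sum_{s}-\frac1{x_s}-\frac1b\sum_{i\in\mathcal I}\tau_i\log\tau_i\quad\text{subject to}\quad\sum_{s:\,l\in s}x_s\le\sum_{i\in\mathcal I:\,l\in i}\tau_i\ \ (l\in E),\qquad\sum_{i\in\mathcal I}\tau_i=1,$$ with $-1/0=-\infty$ and $0\log 0=0$. Then, with $b=2k^2\beta$ (so that $b=\beta$ for the normalization $k=1/\sqrt2$): (1) If $(x,r)$ is an equilibrium of the system, then $(x,\tau(r))$ is an optimal solution of $\mathbf{MP}(b)$. (2) $\mathbf{MP}(b)$ has a unique optimal solution $(x^*,\tau^*)$. The system has a unique equilibrium; it is of the form $(x^*,r^*)$ with $\tau(r^*)=\tau^*$, and it is globally asymptotically stable: from every initial state there starts a (Carathéodory) solution on $[0,\infty)$, the equilibrium is Lyapunov stable, and every solution $(x(t),r(t))$ that starts at a state converges to $(x^*,r^*)$ as $t\to\infty$.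 In particular every solution satisfies $x(t)\to x^*$ and $\tau(r(t))\to\tau^*$. -/

import Mathlib

open Filter Topology MeasureTheory

noncomputable section

namespace CSMA

variable {E S : Type*} [Fintype E] [DecidableEq E] [Fintype S]

/-- The feasible schedules: all independent sets of links of the conflict graph (the empty set,
i.e. the idle channel, is one of them). -/
abbrev Schedule (Gc : SimpleGraph E) : Type _ := {i : Finset E // Gc.IsIndepSet (i : Set E)}

instance (Gc : SimpleGraph E) : Fintype (Schedule Gc) := Fintype.ofFinite _

/-- The Gibbs distribution `τ_i(r) = exp(∑_{l ∈ i} β r_l) / ∑_{i'} exp(∑_{l ∈ i'} β r_l)`. -/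
def gibbs (Gc : SimpleGraph E) (β : ℝ) (r : E → ℝ) (i : Schedule Gc) : ℝ :=
  Real.exp (∑ l ∈ i.1, β * r l) / ∑ j : Schedule Gc, Real.exp (∑ l ∈ j.1, β * r l)

/-- The load `∑_{s : l ∈ s} x_s` that the flow rates `x` put on link `l`. -/
def linkLoad (route : S → Finset E) (x : S → ℝ) (l : E) : ℝ :=
  ∑ s : S with l ∈ route s, x s

/-- The airtime `∑_{i : l ∈ i} τ_i` that link `l` gets from the time portions `τ`. -/
def linkService (Gc : SimpleGraph E) (τ : Schedule Gc → ℝ) (l : E) : ℝ :=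
  ∑ i : Schedule Gc with l ∈ i.1, τ i

/-! ### The optimization problem -/

/-- Feasibility in the network utility maximization problem. -/
def IsFeasible (Gc : SimpleGraph E) (route : S → Finset E)
    (x : S → ℝ) (τ : Schedule Gc → ℝ) : Prop :=
  (∀ s, 0 ≤ x s) ∧ (∀ i, 0 ≤ τ i) ∧
    (∀ l, linkLoad route x l ≤ linkService Gc τ l) ∧ ∑ i, τ i = 1

open Classical in
/-- The objective `∑_s -1/x_s - (1/β) ∑_i τ_i log τ_i` at a point with `x ≥ 0`, `τ ≥ 0`; the
utility of a zero rate is `-∞`, and `0 log 0 = 0`. -/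
def objective (Gc : SimpleGraph E) (β : ℝ) (x : S → ℝ) (τ : Schedule Gc → ℝ) : EReal :=
  if ∀ s, 0 < x s then
    ((∑ s, -(1 / x s) - 1 / β * ∑ i, τ i * Real.log (τ i) : ℝ) : EReal)
  else ⊥

/-- `(x, τ)` is an optimal solution of the problem **MP** with entropy weight `1/β`. -/
def SolvesMP (Gc : SimpleGraph E) (route : S → Finset E) (β : ℝ)
    (x : S → ℝ) (τ : Schedule Gc → ℝ) : Prop :=
  IsFeasible Gc route x τ ∧
    ∀ (x' : S → ℝ) (τ' : Schedule Gc → ℝ), IsFeasible Gc route x' τ' →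
      objective Gc β x' τ' ≤ objective Gc β x τ

/-! ### The dynamical system -/

/-- The projection `[g]_z^+`: equal to `max(g, 0)` if `z ≤ 0` and to `g` otherwise. -/
def proj (g z : ℝ) : ℝ := if z ≤ 0 then max g 0 else g

/-- The number of connections `n_s = k T_s`. -/
def connections (k : ℝ) (T : S → ℝ) (s : S) : ℝ := k * T s

/-- The right-hand side of the equation for the rate `x_s`. -/
def rateField (route : S → Finset E) (k : ℝ) (T : S → ℝ)
    (x : S → ℝ) (r : E → ℝ) (s : S) : ℝ :=
  x s ^ 2 / (2 * connections k T s) *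
    proj (2 * connections k T s ^ 2 / (T s ^ 2 * x s ^ 2) - ∑ l ∈ route s, r l) (x s)

/-- The right-hand side of the equation for the transmission aggressiveness `r_l`, the schedules
being distributed according to the stationary distribution `τ(r)`. -/
def aggrField (Gc : SimpleGraph E) (route : S → Finset E) (α β : ℝ)
    (x : S → ℝ) (r : E → ℝ) (l : E) : ℝ :=
  α * proj (linkLoad route x l - linkService Gc (gibbs Gc β r) l) (r l)

/-- The states of the system: `x > 0` (the equations divide by `x_s`) and `r ≥ 0`. -/
def IsState (x : S → ℝ) (r : E → ℝ) : Prop := (∀ s, 0 < x s) ∧ ∀ l, 0 ≤ r l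

/-- A state at which all right-hand sides vanish. -/
def IsEquilibrium (Gc : SimpleGraph E) (route : S → Finset E) (α β k : ℝ) (T : S → ℝ)
    (x : S → ℝ) (r : E → ℝ) : Prop :=
  IsState x r ∧ (∀ s, rateField route k T x r s = 0) ∧ ∀ l, aggrField Gc route α β x r l = 0

/-- A solution on `[0, ∞)` that starts at a state, in the sense of Carathéodory (the right-hand
side is discontinuous): every coordinate is locally absolutely continuous and satisfies its
differential equation at almost every time. That the solution remains among the states is not
required. -/
def IsTrajectory (Gc : SimpleGraph E) (route : S → Finset E) (α β k : ℝ) (T : S → ℝ)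
    (x : ℝ → S → ℝ) (r : ℝ → E → ℝ) : Prop :=
  IsState (x 0) (r 0) ∧
    (∀ b, 0 ≤ b → (∀ s, AbsolutelyContinuousOnInterval (fun t => x t s) 0 b) ∧
      ∀ l, AbsolutelyContinuousOnInterval (fun t => r t l) 0 b) ∧
    ∀ᵐ t ∂(volume.restrict (Set.Ici (0 : ℝ))),
      (∀ s, HasDerivAt (fun u => x u s) (rateField route k T (x t) (r t) s) t) ∧
        ∀ l, HasDerivAt (fun u => r u l) (aggrField Gc route α β (x t) (r t) l) t

/-- The point `(xs, rs)` is globally asymptotically stable: from every state there starts a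
solution for all times, `(xs, rs)` is stable, and all solutions converge to it. -/
def IsGloballyAsymptoticallyStable (Gc : SimpleGraph E) (route : S → Finset E)
    (α β k : ℝ) (T : S → ℝ) (xs : S → ℝ) (rs : E → ℝ) : Prop :=
  (∀ (x₀ : S → ℝ) (r₀ : E → ℝ), IsState x₀ r₀ →
    ∃ x r, IsTrajectory Gc route α β k T x r ∧ x 0 = x₀ ∧ r 0 = r₀) ∧
  (∀ ε > 0, ∃ δ > 0, ∀ x r, IsTrajectory Gc route α β k T x r →
    dist (x 0, r 0) (xs, rs) < δ → ∀ t, 0 ≤ t → dist (x t, r t) (xs, rs) < ε) ∧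
  ∀ x r, IsTrajectory Gc route α β k T x r → Tendsto (fun t => (x t, r t)) atTop (𝓝 (xs, rs))

end CSMA

end

/-!
Write `q_s = ∑_{l ∈ s} r_l` for the price of a route, `y_l` for the load and `S_l(r)` for the service
of a link under the Gibbs distribution. As long as the rates are positive the rate equation reads
`x_s' = (2 k² - x_s² q_s) / (2 n_s)`, so equilibria are the points with `x_s² q_s = 2 k²`,
`y_l ≤ S_l` and `r_l (y_l - S_l) = 0`. These are the Karush–Kuhn–Tucker conditions of the utility
maximization problem with multipliers `r / (2 k²)`; the Gibbs distribution is the stationarity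
condition in the time portions (`isEquilibrium_iff`).

*Optimality.* Linearizing the utilities and using Gibbs' inequality, the objective at an equilibrium
exceeds that at a feasible point by at least a positive definite quantity, namely the second-order
remainder of the utilities plus a Kullback–Leibler divergence (`gap_le`). This gives optimality and
uniqueness of the optimum, and uniqueness of the equilibrium because `r` can be read off from the
Gibbs distribution. An equilibrium exists since the dual function attains its minimum over the
orthant (`exists_isEquilibrium`).

*Stability.* The function `lyapunov` decays along solutions at least at the rate `dissipation`, which
is continuous and vanishes only at the equilibrium (`lyapunov_deriv_le`, `dissipation_pos`). Its
sublevel sets lie in compact boxes with rates bounded away from zero, so no invariance principle is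
needed: a solution cannot leave such a box (`SolvesWithin.mem_box`), and the decay rate is bounded
below as long as the Lyapunov function is not small.

*Existence of solutions.* The right-hand side is discontinuous where some `r_l = 0`. If `w` is the
integral of the unprojected right-hand side, then `r = w + sup_{u ≤ t} (-w(u))⁺` solves the projected
equation almost everywhere (`ae_hasDerivAt_reflection`). As this Skorokhod reflection is causal and
Lipschitz in the sup norm, the system becomes a causal integral equation for `(x, w)`, which is
solved by a contraction (`exists_eq_add_integral`) after clamping the field outside a box that the
solution never leaves.
-/

set_option linter.unusedSectionVars false

namespace CSMA

variable {E S : Type*} [Fintype E] [DecidableEq E] [Fintype S]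

/-! ### The Gibbs distribution and exchange of sums -/

lemma sum_exp_pos (Gc : SimpleGraph E) (β : ℝ) (r : E → ℝ) :
    0 < ∑ j : Schedule Gc, Real.exp (∑ l ∈ j.1, β * r l) :=
  Finset.sum_pos (fun _ _ => Real.exp_pos _) ⟨⟨∅, by simp⟩, Finset.mem_univ _⟩

lemma gibbs_pos (Gc : SimpleGraph E) (β : ℝ) (r : E → ℝ) (i : Schedule Gc) : 0 < gibbs Gc β r i :=
  div_pos (Real.exp_pos _) (sum_exp_pos Gc β r)

lemma sum_gibbs (Gc : SimpleGraph E) (β : ℝ) (r : E → ℝ) : ∑ i, gibbs Gc β r i = 1 := by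
  unfold gibbs
  rw [← Finset.sum_div, div_self (sum_exp_pos Gc β r).ne']

lemma log_gibbs (Gc : SimpleGraph E) (β : ℝ) (r : E → ℝ) (i : Schedule Gc) :
    Real.log (gibbs Gc β r i) =
      β * ∑ l ∈ i.1, r l - Real.log (∑ j : Schedule Gc, Real.exp (∑ l ∈ j.1, β * r l)) := by
  unfold gibbs
  rw [Real.log_div (Real.exp_pos _).ne' (sum_exp_pos Gc β r).ne', Real.log_exp, Finset.mul_sum]

/-- A schedule that consists of the single link `l` is feasible. Comparing it with the idle
schedule recovers `r l` from the Gibbs distribution. -/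
lemma gibbs_injective (Gc : SimpleGraph E) {β : ℝ} (hβ : 0 < β) :
    Function.Injective (gibbs Gc β) := by
  intro r r' h
  funext l
  have h1 := congrArg Real.log (congrFun h ⟨{l}, by simp⟩)
  have h0 := congrArg Real.log (congrFun h ⟨∅, by simp⟩)
  simp only [log_gibbs, Finset.sum_singleton, Finset.sum_empty] at h1 h0
  have : β * r l = β * r' l := by linarith
  exact mul_left_cancel₀ hβ.ne' this

lemma continuous_gibbs (Gc : SimpleGraph E) (β : ℝ) : Continuous (gibbs Gc β) := by
  refine continuous_pi fun i => ?_
  unfold gibbs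
  exact Continuous.div (by fun_prop) (by fun_prop) fun r => (sum_exp_pos Gc β r).ne'

lemma sum_mul_linkLoad (route : S → Finset E) (x : S → ℝ) (c : E → ℝ) :
    ∑ l, c l * linkLoad route x l = ∑ s, x s * ∑ l ∈ route s, c l := by
  simp only [linkLoad, Finset.mul_sum, Finset.sum_filter, mul_ite, mul_zero]
  rw [Finset.sum_comm]
  refine Finset.sum_congr rfl fun s _ => ?_
  rw [← Finset.sum_filter, Finset.filter_mem_eq_inter, Finset.univ_inter]
  exact Finset.sum_congr rfl fun l _ => mul_comm _ _

lemma sum_mul_linkService (Gc : SimpleGraph E) (τ : Schedule Gc → ℝ) (c : E → ℝ) :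
    ∑ l, c l * linkService Gc τ l = ∑ i, τ i * ∑ l ∈ i.1, c l :=
  sum_mul_linkLoad (fun i : Schedule Gc => i.1) τ c

/-! ### Equilibria are the Karush–Kuhn–Tucker points -/

lemma proj_eq_zero_iff {g z : ℝ} (hz : 0 ≤ z) : proj g z = 0 ↔ g ≤ 0 ∧ z * g = 0 := by
  unfold proj
  rcases hz.eq_or_lt with rfl | hz
  · simp
  · rw [if_neg hz.not_ge]
    constructor
    · rintro rfl; simp
    · rintro ⟨-, h⟩
      exact (mul_eq_zero.1 h).resolve_left hz.ne'

/-- At a positive rate the projection is inactive and `2 n_s² / T_s² = 2 k²`. -/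
lemma rateField_eq (route : S → Finset E) {k : ℝ} (hk : 0 < k) {T : S → ℝ} (hT : ∀ s, 0 < T s)
    {x : S → ℝ} (r : E → ℝ) {s : S} (hx : 0 < x s) :
    rateField route k T x r s =
      (2 * k ^ 2 - x s ^ 2 * ∑ l ∈ route s, r l) / (2 * connections k T s) := by
  have := hT s
  rw [rateField, proj, if_neg hx.not_ge, connections]
  field_simp

/-- The equilibrium conditions are the Karush–Kuhn–Tucker conditions of the utility maximization
problem: stationarity in the rates, primal feasibility, complementary slackness. -/
lemma isEquilibrium_iff (Gc : SimpleGraph E) (route : S → Finset E) {α β k : ℝ} (hα : 0 < α)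
    (hk : 0 < k) {T : S → ℝ} (hT : ∀ s, 0 < T s) (x : S → ℝ) (r : E → ℝ) :
    IsEquilibrium Gc route α β k T x r ↔
      IsState x r ∧ (∀ s, x s ^ 2 * ∑ l ∈ route s, r l = 2 * k ^ 2) ∧
        ∀ l, linkLoad route x l ≤ linkService Gc (gibbs Gc β r) l ∧
          r l * (linkLoad route x l - linkService Gc (gibbs Gc β r) l) = 0 := by
  unfold IsEquilibrium
  refine and_congr_right fun hst => and_congr (forall_congr' fun s => ?_)
    (forall_congr' fun l => ?_)
  · have h : 0 < connections k T s := mul_pos hk (hT s)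
    rw [rateField_eq route hk hT r (hst.1 s), div_eq_zero_iff, or_iff_left (by positivity),
      sub_eq_zero, eq_comm]
  · rw [aggrField, mul_eq_zero, or_iff_right hα.ne', proj_eq_zero_iff (hst.2 l), sub_nonpos]

/-! ### Optimality -/

/-- The Kullback–Leibler divergence of `τ'` from `τ` as a sum of nonnegative terms. -/
lemma sum_mul_klFun {ι : Type*} [Fintype ι] {τ τ' : ι → ℝ} (hτ : ∀ i, 0 < τ i)
    (h1 : ∑ i, τ i = 1) (h1' : ∑ i, τ' i = 1) :
    ∑ i, τ i * InformationTheory.klFun (τ' i / τ i) =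
      ∑ i, τ' i * Real.log (τ' i) - ∑ i, τ' i * Real.log (τ i) := by
  have : ∀ i, τ i * InformationTheory.klFun (τ' i / τ i) =
      τ' i * Real.log (τ' i) - τ' i * Real.log (τ i) + (τ i - τ' i) := by
    intro i
    have hi := hτ i
    rw [InformationTheory.klFun_apply]
    by_cases h0 : τ' i = 0
    · simp [h0]
    · rw [Real.log_div h0 hi.ne']
      field_simp
      ring
  simp_rw [this, Finset.sum_add_distrib, Finset.sum_sub_distrib, h1, h1']
  ring

/-- The duality gap: an equilibrium beats every feasible point by at least the second-order
remainder of the utilities plus the Kullback–Leibler divergence of the schedule distributions. -/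
lemma gap_le (Gc : SimpleGraph E) (route : S → Finset E) {β k : ℝ} (hβ : 0 < β) (hk : 0 < k)
    {x : S → ℝ} {r : E → ℝ} (hst : IsState x r)
    (hx : ∀ s, x s ^ 2 * ∑ l ∈ route s, r l = 2 * k ^ 2)
    (hr : ∀ l, linkLoad route x l ≤ linkService Gc (gibbs Gc β r) l ∧
      r l * (linkLoad route x l - linkService Gc (gibbs Gc β r) l) = 0)
    {x' : S → ℝ} {τ' : Schedule Gc → ℝ} (hf : IsFeasible Gc route x' τ') (hx' : ∀ s, 0 < x' s) :
    ∑ s, (x' s - x s) ^ 2 / (x' s * x s ^ 2) + 1 / (2 * k ^ 2 * β) *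
        ∑ i, gibbs Gc β r i * InformationTheory.klFun (τ' i / gibbs Gc β r i) ≤
      (∑ s, -(1 / x s) - 1 / (2 * k ^ 2 * β) *
          ∑ i, gibbs Gc β r i * Real.log (gibbs Gc β r i)) -
        (∑ s, -(1 / x' s) - 1 / (2 * k ^ 2 * β) * ∑ i, τ' i * Real.log (τ' i)) := by
  set τ := gibbs Gc β r with hτ
  rw [sum_mul_klFun (gibbs_pos Gc β r) (sum_gibbs Gc β r) hf.2.2.2, ← hτ]
  have hu : ∀ s, (x' s - x s) ^ 2 / (x' s * x s ^ 2) =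
      -(1 / x s) - -(1 / x' s) + (x' s - x s) * ∑ l ∈ route s, r l / (2 * k ^ 2) := by
    intro s
    have h1 := hst.1 s
    have h2 := hx' s
    rw [← Finset.sum_div, show ∑ l ∈ route s, r l = 2 * k ^ 2 / x s ^ 2 by
      rw [eq_div_iff (by positivity), ← hx s]; ring]
    field_simp
    ring
  have he : ∑ i, (τ' i - τ i) * Real.log (τ i) =
      β * ∑ l, r l * (linkService Gc τ' l - linkService Gc τ l) := by
    simp only [mul_sub, Finset.sum_sub_distrib, sum_mul_linkService]
    simp only [sub_mul, Finset.sum_sub_distrib, hτ, log_gibbs, mul_sub, ← Finset.sum_mul,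
      sum_gibbs, hf.2.2.2, Finset.mul_sum]
    rw [sub_self, sub_zero]
    congr 1 <;>
    · refine Finset.sum_congr rfl fun i _ => Finset.sum_congr rfl fun l _ => by ring
  have hl : ∑ s, (x' s - x s) * ∑ l ∈ route s, r l / (2 * k ^ 2) =
      ∑ l, r l / (2 * k ^ 2) * (linkLoad route x' l - linkLoad route x l) := by
    simp only [mul_sub, sub_mul, Finset.sum_sub_distrib, sum_mul_linkLoad]
  have hle : ∑ l, r l / (2 * k ^ 2) * (linkLoad route x' l - linkLoad route x l) ≤
      ∑ l, r l / (2 * k ^ 2) * (linkService Gc τ' l - linkService Gc τ l) := by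
    refine Finset.sum_le_sum fun l _ => ?_
    have h1 := mul_le_mul_of_nonneg_left (hf.2.2.1 l) (hst.2 l)
    have h2 := (hr l).2
    rw [div_mul_eq_mul_div, div_mul_eq_mul_div]
    refine div_le_div_of_nonneg_right ?_ (by positivity)
    linarith
  have hs : ∑ l, r l / (2 * k ^ 2) * (linkService Gc τ' l - linkService Gc τ l) =
      1 / (2 * k ^ 2 * β) * ∑ i, (τ' i - τ i) * Real.log (τ i) := by
    rw [he, Finset.mul_sum, Finset.mul_sum]
    exact Finset.sum_congr rfl fun l _ => by field_simp
  have hsplit : ∑ i, (τ' i - τ i) * Real.log (τ i) =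
      ∑ i, τ' i * Real.log (τ i) - ∑ i, τ i * Real.log (τ i) := by
    simp only [sub_mul, Finset.sum_sub_distrib]
  rw [hsplit, mul_sub] at hs
  simp_rw [hu]
  rw [Finset.sum_add_distrib, Finset.sum_sub_distrib]
  linarith

lemma solvesMP_of_isEquilibrium (Gc : SimpleGraph E) (route : S → Finset E) {α β k : ℝ}
    (hα : 0 < α) (hβ : 0 < β) (hk : 0 < k) {T : S → ℝ} (hT : ∀ s, 0 < T s) {x : S → ℝ}
    {r : E → ℝ} (h : IsEquilibrium Gc route α β k T x r) :
    SolvesMP Gc route (2 * k ^ 2 * β) x (gibbs Gc β r) := by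
  obtain ⟨hst, hx, hr⟩ := (isEquilibrium_iff Gc route hα hk hT x r).1 h
  refine ⟨⟨fun s => (hst.1 s).le, fun i => (gibbs_pos Gc β r i).le, fun l => (hr l).1,
    sum_gibbs Gc β r⟩, fun x' τ' hf => ?_⟩
  unfold objective
  rw [if_pos hst.1]
  split_ifs with hx'
  · have hgap := gap_le Gc route hβ hk hst hx hr hf hx'
    refine EReal.coe_le_coe_iff.2 (sub_nonneg.1 (le_trans ?_ hgap))
    refine add_nonneg (Finset.sum_nonneg fun s _ => ?_)
      (mul_nonneg (by positivity) (Finset.sum_nonneg fun i _ => mul_nonneg (gibbs_pos Gc β r i).le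
        (InformationTheory.klFun_nonneg (div_nonneg (hf.2.1 i) (gibbs_pos Gc β r i).le))))
    have := hx' s
    positivity
  · exact bot_le

/-- Any other optimal solution has zero duality gap, so it agrees with the one given by an
equilibrium. -/
lemma eq_of_solvesMP (Gc : SimpleGraph E) (route : S → Finset E) {α β k : ℝ}
    (hα : 0 < α) (hβ : 0 < β) (hk : 0 < k) {T : S → ℝ} (hT : ∀ s, 0 < T s) {x : S → ℝ}
    {r : E → ℝ} (h : IsEquilibrium Gc route α β k T x r) {x' : S → ℝ} {τ' : Schedule Gc → ℝ}
    (h' : SolvesMP Gc route (2 * k ^ 2 * β) x' τ') : x' = x ∧ τ' = gibbs Gc β r := by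
  obtain ⟨hst, hx, hr⟩ := (isEquilibrium_iff Gc route hα hk hT x r).1 h
  have hle := h'.2 _ _ (solvesMP_of_isEquilibrium Gc route hα hβ hk hT h).1
  have hf := h'.1
  unfold objective at hle
  rw [if_pos hst.1] at hle
  split_ifs at hle with hx'
  swap
  · exact absurd (le_bot_iff.1 hle) (EReal.coe_ne_bot _)
  have hgap := (gap_le Gc route hβ hk hst hx hr hf hx').trans
    (sub_nonpos.2 (EReal.coe_le_coe_iff.1 hle))
  have h1 : ∀ s ∈ Finset.univ, 0 ≤ (x' s - x s) ^ 2 / (x' s * x s ^ 2) := fun s _ => by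
    have := hx' s
    positivity
  have h2 : ∀ i ∈ Finset.univ,
      0 ≤ gibbs Gc β r i * InformationTheory.klFun (τ' i / gibbs Gc β r i) := fun i _ =>
    mul_nonneg (gibbs_pos Gc β r i).le
        (InformationTheory.klFun_nonneg (div_nonneg (hf.2.1 i) (gibbs_pos Gc β r i).le))
  have hb : 0 < 1 / (2 * k ^ 2 * β) := by positivity
  have h3 := Finset.sum_nonneg h1
  have h4 := mul_nonneg hb.le (Finset.sum_nonneg h2)
  obtain ⟨hx0, hτ0⟩ := (add_eq_zero_iff_of_nonneg h3 h4).1 (le_antisymm hgap (add_nonneg h3 h4))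
  constructor
  · funext s
    have := (Finset.sum_eq_zero_iff_of_nonneg h1).1 hx0 s (Finset.mem_univ s)
    have p1 := hx' s
    have p2 := hst.1 s
    rw [div_eq_zero_iff, or_iff_left (by positivity)] at this
    exact sub_eq_zero.1 (pow_eq_zero_iff two_ne_zero |>.1 this)
  · funext i
    have h5 := (mul_eq_zero.1 hτ0).resolve_left hb.ne'
    have := (Finset.sum_eq_zero_iff_of_nonneg h2).1 h5 i (Finset.mem_univ i)
    have p := gibbs_pos Gc β r i
    have := (InformationTheory.klFun_eq_zero_iff (div_nonneg (hf.2.1 i) p.le)).1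
      ((mul_eq_zero.1 this).resolve_left p.ne')
    exact (div_eq_one_iff_eq p.ne').1 this

lemma isEquilibrium_unique (Gc : SimpleGraph E) (route : S → Finset E) {α β k : ℝ}
    (hα : 0 < α) (hβ : 0 < β) (hk : 0 < k) {T : S → ℝ} (hT : ∀ s, 0 < T s) {x x' : S → ℝ}
    {r r' : E → ℝ} (h : IsEquilibrium Gc route α β k T x r)
    (h' : IsEquilibrium Gc route α β k T x' r') : x' = x ∧ r' = r :=
  (eq_of_solvesMP Gc route hα hβ hk hT h
    (solvesMP_of_isEquilibrium Gc route hα hβ hk hT h')).imp_right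
      fun e => gibbs_injective Gc hβ e

/-! ### The dual problem and existence of an equilibrium -/

/-- The Lagrange dual function of the utility maximization problem, in the multipliers
`r / (2 k²)` of the link constraints and scaled by `2 k²`, to be minimized over `r ≥ 0`. -/
noncomputable def dual (Gc : SimpleGraph E) (route : S → Finset E) (β k : ℝ) (r : E → ℝ) : ℝ :=
  1 / β * Real.log (∑ j : Schedule Gc, Real.exp (β * ∑ l ∈ j.1, r l)) -
    2 * √(2 * k ^ 2) * ∑ s, √(∑ l ∈ route s, r l)

lemma sum_exp_mul_pos (Gc : SimpleGraph E) (β : ℝ) (r : E → ℝ) :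
    0 < ∑ j : Schedule Gc, Real.exp (β * ∑ l ∈ j.1, r l) := by
  simpa only [Finset.mul_sum] using sum_exp_pos Gc β r

lemma continuous_dual (Gc : SimpleGraph E) (route : S → Finset E) (β k : ℝ) :
    Continuous (dual Gc route β k) := by
  unfold dual
  refine (continuous_const.mul (Continuous.log (by fun_prop) fun r => ?_)).sub (by fun_prop)
  exact (sum_exp_mul_pos Gc β r).ne'

lemma le_log_sum_exp (Gc : SimpleGraph E) {β : ℝ} (hβ : 0 < β) (r : E → ℝ) (l : E) :
    r l ≤ 1 / β * Real.log (∑ j : Schedule Gc, Real.exp (β * ∑ l ∈ j.1, r l)) := by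
  have h : Real.exp (β * r l) ≤ ∑ j : Schedule Gc, Real.exp (β * ∑ l ∈ j.1, r l) := by
    have := Finset.single_le_sum (f := fun j : Schedule Gc => Real.exp (β * ∑ l ∈ j.1, r l))
      (fun j _ => (Real.exp_pos _).le) (Finset.mem_univ ⟨{l}, by simp⟩)
    simpa using this
  have h2 := (Real.le_log_iff_exp_le (sum_exp_mul_pos Gc β r)).2 h
  rw [one_div_mul_eq_div, le_div_iff₀ hβ]
  linarith

/-- The dual function is coercive on the orthant: it grows linearly in the largest multiplier up
to a square-root term. -/
lemma exists_isMinOn_dual (Gc : SimpleGraph E) (route : S → Finset E) {β : ℝ} (hβ : 0 < β)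
    (k : ℝ) : ∃ r : E → ℝ, (∀ l, 0 ≤ r l) ∧
      ∀ r' : E → ℝ, (∀ l, 0 ≤ r' l) → dual Gc route β k r ≤ dual Gc route β k r' := by
  set C : ℝ := 2 * √(2 * k ^ 2) * (Fintype.card S * √(Fintype.card E)) with hC
  have hC0 : 0 ≤ C := by positivity
  set c₀ : ℝ := |dual Gc route β k 0| with hc₀
  have hc₀0 : 0 ≤ c₀ := abs_nonneg _
  -- For `ρ > (C + c₀ + 1)²` one has `ρ - C √ρ = √ρ (√ρ - C) > c₀`.
  set R : ℝ := (C + c₀ + 1) ^ 2 with hR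
  have hR0 : 0 ≤ R := sq_nonneg _
  have hbox : (Set.Icc (0 : E → ℝ) fun _ => R).Nonempty := ⟨0, le_rfl, fun _ => hR0⟩
  obtain ⟨r, hr, hmin⟩ := isCompact_Icc.exists_isMinOn hbox
    (continuous_dual Gc route β k).continuousOn
  refine ⟨r, hr.1, fun r' hr' => ?_⟩
  by_cases h : ∀ l, r' l ≤ R
  · exact hmin ⟨hr', h⟩
  push Not at h
  obtain ⟨l₀, hl₀⟩ := h
  obtain ⟨l, -, hl⟩ := Finset.exists_max_image Finset.univ r' ⟨l₀, Finset.mem_univ _⟩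
  have hlR : R < r' l := hl₀.trans_le (hl l₀ (Finset.mem_univ _))
  have h1 := le_log_sum_exp Gc hβ r' l
  have h2 : ∑ s, √(∑ m ∈ route s, r' m) ≤ Fintype.card S * √(Fintype.card E) * √(r' l) := by
    calc ∑ s, √(∑ m ∈ route s, r' m) ≤ ∑ _s : S, √(Fintype.card E) * √(r' l) := by
          refine Finset.sum_le_sum fun s _ => ?_
          rw [← Real.sqrt_mul (by positivity)]
          refine Real.sqrt_le_sqrt ?_
          calc ∑ m ∈ route s, r' m ≤ ∑ m, r' m :=
                Finset.sum_le_sum_of_subset_of_nonneg (Finset.subset_univ _) fun m _ _ => hr' m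
            _ ≤ ∑ _m : E, r' l := Finset.sum_le_sum fun m _ => hl m (Finset.mem_univ _)
            _ = _ := by simp
      _ = _ := by simp [mul_assoc]
  have h3 : r' l - C * √(r' l) ≤ dual Gc route β k r' := by
    unfold dual
    have := mul_le_mul_of_nonneg_left h2 (show 0 ≤ 2 * √(2 * k ^ 2) by positivity)
    have e : 2 * √(2 * k ^ 2) * (Fintype.card S * √(Fintype.card E) * √(r' l)) = C * √(r' l) := by
      rw [hC]; ring
    linarith
  have h4 : C + c₀ + 1 < √(r' l) := Real.lt_sqrt_of_sq_lt hlR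
  have h5 : √(r' l) * √(r' l) = r' l := Real.mul_self_sqrt (hr' l)
  have h6 : dual Gc route β k r ≤ c₀ := 
    (hmin (show (0 : E → ℝ) ∈ _ from ⟨le_rfl, fun _ => hR0⟩)).trans (le_abs_self _)
  nlinarith

lemma sum_add_single (A : Finset E) (r : E → ℝ) (l : E) (t : ℝ) :
    ∑ m ∈ A, (r m + t * (Pi.single l 1 : E → ℝ) m) =
      ∑ m ∈ A, r m + t * if l ∈ A then 1 else 0 := by
  rw [Finset.sum_add_distrib, ← Finset.mul_sum]
  simp [Pi.single_apply]

/-- At a minimizer of the dual function every route has positive price: the slope of the square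
root at zero is infinite, while the log-partition term grows at most at unit rate. -/
lemma sum_pos_of_isMin_dual (Gc : SimpleGraph E) (route : S → Finset E)
    (hroute : ∀ s, (route s).Nonempty) {β k : ℝ} (hβ : 0 < β) (hk : 0 < k) {r : E → ℝ}
    (hr : ∀ l, 0 ≤ r l)
    (hmin : ∀ r' : E → ℝ, (∀ l, 0 ≤ r' l) → dual Gc route β k r ≤ dual Gc route β k r') (s : S) :
    0 < ∑ l ∈ route s, r l := by
  refine (Finset.sum_nonneg fun l _ => hr l).lt_of_ne fun h0 => ?_
  obtain ⟨l, hl⟩ := hroute s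
  -- Raising `r l` by `k²` costs at most `k²` in the log-partition term and gains at least
  -- `2 √(2 k²) √(k²) > k²` in the square-root term of the route `s`.
  set r' : E → ℝ := fun m => r m + k ^ 2 * (Pi.single l 1 : E → ℝ) m with hr'
  have hsum : ∀ A : Finset E, ∑ m ∈ A, r' m = ∑ m ∈ A, r m + k ^ 2 * if l ∈ A then 1 else 0 :=
    fun A => sum_add_single A r l (k ^ 2)
  have h := hmin r' fun m => by
    have : 0 ≤ (Pi.single l 1 : E → ℝ) m := by
      by_cases e : m = l
      · subst e; simp
      · simp [e]
    have := hr m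
    positivity
  have hZ : Real.log (∑ j : Schedule Gc, Real.exp (β * ∑ m ∈ j.1, r' m)) ≤
      β * k ^ 2 + Real.log (∑ j : Schedule Gc, Real.exp (β * ∑ m ∈ j.1, r m)) := by
    rw [← Real.log_exp (β * k ^ 2), ← Real.log_mul (Real.exp_pos _).ne' (sum_exp_mul_pos Gc β r).ne']
    refine Real.log_le_log (sum_exp_mul_pos Gc β r') ?_
    rw [Finset.mul_sum]
    refine Finset.sum_le_sum fun j _ => ?_
    rw [← Real.exp_add, hsum, Real.exp_le_exp]
    split_ifs <;> nlinarith [mul_pos hβ (pow_pos hk 2)]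
  have hq : ∑ s', √(∑ m ∈ route s', r m) + k ≤ ∑ s', √(∑ m ∈ route s', r' m) := by
    have : ∀ s' ∈ Finset.univ, 0 ≤ √(∑ m ∈ route s', r' m) - √(∑ m ∈ route s', r m) :=
      fun s' _ => by
        refine sub_nonneg.2 (Real.sqrt_le_sqrt ?_)
        rw [hsum]
        split_ifs <;> nlinarith
    have := Finset.single_le_sum this (Finset.mem_univ s)
    rw [Finset.sum_sub_distrib] at this
    have e : √(∑ m ∈ route s, r' m) - √(∑ m ∈ route s, r m) = k := by
      rw [hsum, ← h0, if_pos hl, zero_add, mul_one, Real.sqrt_sq hk.le, Real.sqrt_zero, sub_zero]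
    linarith
  have hs : k ≤ √(2 * k ^ 2) := Real.le_sqrt_of_sq_le (by nlinarith)
  unfold dual at h
  have h1 : 1 / β * Real.log (∑ j : Schedule Gc, Real.exp (β * ∑ m ∈ j.1, r' m)) ≤
      k ^ 2 + 1 / β * Real.log (∑ j : Schedule Gc, Real.exp (β * ∑ m ∈ j.1, r m)) := by
    have := mul_le_mul_of_nonneg_left hZ (one_div_pos.2 hβ).le
    have e : 1 / β * (β * k ^ 2) = k ^ 2 := by field_simp
    linarith
  have h2 := mul_le_mul_of_nonneg_left hq (show 0 ≤ 2 * √(2 * k ^ 2) by positivity)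
  nlinarith

lemma hasDerivAt_dual (Gc : SimpleGraph E) (route : S → Finset E) {β k : ℝ} (hβ : 0 < β)
    {r : E → ℝ} (hq : ∀ s, 0 < ∑ l ∈ route s, r l) (l : E) :
    HasDerivAt (fun t => dual Gc route β k fun m => r m + t * (Pi.single l 1 : E → ℝ) m)
      (linkService Gc (gibbs Gc β r) l -
        linkLoad route (fun s => √(2 * k ^ 2) / √(∑ l ∈ route s, r l)) l) 0 := by
  unfold dual
  simp only [sum_add_single]
  have hlin : ∀ a c : ℝ, HasDerivAt (fun t : ℝ => a + t * c) c 0 := fun a c => by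
    simpa using ((hasDerivAt_id (0 : ℝ)).mul_const c).const_add a
  have h1 := (HasDerivAt.fun_sum (u := Finset.univ) fun (j : Schedule Gc) _ =>
    ((hlin (∑ m ∈ j.1, r m) (if l ∈ j.1 then 1 else 0)).const_mul β).exp).log
      (by simpa using (sum_exp_mul_pos Gc β r).ne')
  have h2 := HasDerivAt.fun_sum (u := Finset.univ) fun (s : S) _ =>
    (hlin (∑ m ∈ route s, r m) (if l ∈ route s then 1 else 0)).sqrt (by simpa using (hq s).ne')
  refine ((h1.const_mul (1 / β)).sub (h2.const_mul (2 * √(2 * k ^ 2)))).congr_deriv ?_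
  simp only [zero_mul, add_zero]
  congr 1
  · simp only [linkService, gibbs, Finset.sum_filter, Finset.mul_sum, Finset.sum_div]
    refine Finset.sum_congr rfl fun j _ => ?_
    split_ifs
    · field_simp
    · simp
  · simp only [linkLoad, Finset.sum_filter, Finset.mul_sum]
    refine Finset.sum_congr rfl fun s _ => ?_
    split_ifs
    · field_simp
    · simp

lemma nonneg_of_hasDerivAt_of_forall_ge {h : ℝ → ℝ} {h' a : ℝ} (hd : HasDerivAt h h' a)
    (hmin : ∀ t, a ≤ t → h a ≤ h t) : 0 ≤ h' := by
  have := hd.hasDerivWithinAt (s := Set.Ioi a)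
  rw [hasDerivWithinAt_iff_tendsto_slope' (by simp)] at this
  refine ge_of_tendsto this ?_
  filter_upwards [self_mem_nhdsWithin] with t ht
  rw [slope_def_field]
  exact div_nonneg (sub_nonneg.2 (hmin t (le_of_lt ht))) (sub_nonneg.2 (le_of_lt ht))

/-- The minimizer of the dual function is an equilibrium, with the rates that the route prices
dictate. -/
lemma exists_isEquilibrium (Gc : SimpleGraph E) (route : S → Finset E)
    (hroute : ∀ s, (route s).Nonempty) {α β k : ℝ} (hα : 0 < α) (hβ : 0 < β) (hk : 0 < k)
    {T : S → ℝ} (hT : ∀ s, 0 < T s) :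
    ∃ (x : S → ℝ) (r : E → ℝ), IsEquilibrium Gc route α β k T x r := by
  obtain ⟨r, hr, hmin⟩ := exists_isMinOn_dual Gc route hβ k
  have hq := sum_pos_of_isMin_dual Gc route hroute hβ hk hr hmin
  refine ⟨fun s => √(2 * k ^ 2) / √(∑ l ∈ route s, r l), r,
    (isEquilibrium_iff Gc route hα hk hT _ r).2 ⟨⟨fun s => ?_, hr⟩, fun s => ?_, fun l => ?_⟩⟩
  · have := hq s
    positivity
  · have := hq s
    rw [div_pow, Real.sq_sqrt (by positivity), Real.sq_sqrt this.le]
    field_simp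
  have hd := hasDerivAt_dual Gc route (k := k) hβ hq l
  have hge : ∀ t, -r l ≤ t → dual Gc route β k r ≤
      dual Gc route β k fun m => r m + t * (Pi.single l 1 : E → ℝ) m := fun t ht =>
    hmin _ fun m => by
      by_cases e : m = l
      · subst e; simp; linarith
      · simpa [e] using hr m
  have h0 : (dual Gc route β k fun m => r m + 0 * (Pi.single l 1 : E → ℝ) m) =
      dual Gc route β k r := by simp
  constructor
  · have := nonneg_of_hasDerivAt_of_forall_ge hd fun t ht => by
      rw [h0]; exact hge t (by linarith [hr l])
    linarith
  · rcases (hr l).eq_or_lt with h | h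
    · rw [← h, zero_mul]
    · have hloc : IsLocalMin (fun t => dual Gc route β k fun m =>
          r m + t * (Pi.single l 1 : E → ℝ) m) 0 := by
        filter_upwards [lt_mem_nhds (show -r l < 0 by linarith)] with t ht
        rw [h0]
        exact hge t ht.le
      have := hloc.hasDerivAt_eq_zero hd
      rw [← neg_sub, this, neg_zero, mul_zero]

/-! ### Absolutely continuous functions -/

lemma _root_.LipschitzOnWith.comp_absolutelyContinuousOnInterval {g : ℝ → ℝ} {K : NNReal}
    {s : Set ℝ} (hg : LipschitzOnWith K g s) {f : ℝ → ℝ} {a b : ℝ}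
    (hf : AbsolutelyContinuousOnInterval f a b) (hfs : Set.MapsTo f (Set.uIcc a b) s) :
    AbsolutelyContinuousOnInterval (fun t => g (f t)) a b := by
  have h := hf.const_mul (K : ℝ)
  unfold AbsolutelyContinuousOnInterval at h ⊢
  refine squeeze_zero' (Eventually.of_forall fun _ => Finset.sum_nonneg fun _ _ => dist_nonneg)
    ?_ h
  rw [eventually_inf_principal]
  filter_upwards with I hI
  refine Finset.sum_le_sum fun i hi => ?_
  have := hg.dist_le_mul _ (hfs (hI.1 i hi).1) _ (hfs (hI.1 i hi).2)
  rwa [Real.dist_eq (K * _), ← mul_sub, abs_mul, abs_of_nonneg K.coe_nonneg, ← Real.dist_eq]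

lemma _root_.AbsolutelyContinuousOnInterval.finset_sum {ι : Type*} (u : Finset ι)
    {f : ι → ℝ → ℝ} {a b : ℝ} (hf : ∀ i ∈ u, AbsolutelyContinuousOnInterval (f i) a b) :
    AbsolutelyContinuousOnInterval (fun t => ∑ i ∈ u, f i t) a b := by
  classical
  induction u using Finset.induction_on with
  | empty =>
    simpa using (LipschitzWith.const (0 : ℝ)).lipschitzOnWith.absolutelyContinuousOnInterval
  | insert i u hi ih =>
    simp only [Finset.sum_insert hi]
    exact (hf i (Finset.mem_insert_self i u)).add
      (ih fun j hj => hf j (Finset.mem_insert_of_mem hj))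

/-- The mean value inequality for absolutely continuous functions. -/
lemma _root_.AbsolutelyContinuousOnInterval.sub_le_mul_sub {f : ℝ → ℝ} {a b C : ℝ} (hab : a ≤ b)
    (hf : AbsolutelyContinuousOnInterval f a b)
    (hd : ∀ᵐ t, t ∈ Set.Ioo a b → ∃ f', HasDerivAt f f' t ∧ f' ≤ C) :
    f b - f a ≤ C * (b - a) := by
  rw [← hf.integral_deriv_eq_sub, ← smul_eq_mul, smul_eq_mul, mul_comm, ← smul_eq_mul,
    ← intervalIntegral.integral_const]
  refine intervalIntegral.integral_mono_ae_restrict hab hf.intervalIntegrable_deriv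
    (by simp) ?_
  rw [← MeasureTheory.restrict_Ioo_eq_restrict_Icc]
  refine (ae_restrict_iff' measurableSet_Ioo).2 ?_
  filter_upwards [hd] with t ht htm
  obtain ⟨f', h1, h2⟩ := ht htm
  rwa [h1.deriv]

/-- An absolutely continuous function that starts nonnegative and does not decrease while it is
negative stays nonnegative. -/
lemma _root_.AbsolutelyContinuousOnInterval.nonneg {f : ℝ → ℝ} {b : ℝ} (hb : 0 ≤ b)
    (hf : AbsolutelyContinuousOnInterval f 0 b) (h0 : 0 ≤ f 0)
    (hd : ∀ᵐ t, t ∈ Set.Ioo 0 b → ∃ f', HasDerivAt f f' t ∧ (f t ≤ 0 → 0 ≤ f')) : 0 ≤ f b := by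
  by_contra! hneg
  have hc : ContinuousOn f (Set.Icc 0 b) := by
    simpa [Set.uIcc_of_le hb] using hf.continuousOn
  obtain ⟨a, ⟨ha, hfa⟩, hmax⟩ := (isCompact_Icc.of_isClosed_subset
    (hc.preimage_isClosed_of_isClosed isClosed_Icc isClosed_Ici)
    Set.inter_subset_left).exists_isGreatest
    (show (Set.Icc 0 b ∩ f ⁻¹' Set.Ici 0).Nonempty from ⟨0, ⟨le_rfl, hb⟩, h0⟩)
  have hsub : Set.uIcc a b ⊆ Set.uIcc 0 b := by
    rw [Set.uIcc_of_le hb, Set.uIcc_of_le ha.2]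
    exact Set.Icc_subset_Icc_left ha.1
  have := (hf.mono hsub).fun_neg.sub_le_mul_sub (C := 0) ha.2 (by
    filter_upwards [hd] with t ht htm
    obtain ⟨f', h1, h2⟩ := ht ⟨ha.1.trans_lt htm.1, htm.2⟩
    refine ⟨-f', h1.neg, neg_nonpos.2 (h2 ?_)⟩
    by_contra! hpos
    exact htm.1.not_ge (hmax ⟨⟨ha.1.trans htm.1.le, htm.2.le⟩, hpos.le⟩))
  have : 0 ≤ f a := hfa
  linarith

/-! ### The Lyapunov function -/

/-- The Lyapunov function for the equilibrium `(xs, rs)`: the square of the distance in the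
multipliers, and in each rate the integral of `2 n_s (x_s - x_s*) / x_s²`, which compensates the
gain `x_s² / (2 n_s)` of the rate equation. -/
noncomputable def lyapunov (α k : ℝ) (T : S → ℝ) (xs : S → ℝ) (rs : E → ℝ)
    (z : (S → ℝ) × (E → ℝ)) : ℝ :=
  ∑ s, 2 * connections k T s * (xs s / z.1 s - 1 - Real.log (xs s / z.1 s)) +
    ∑ l, (z.2 l - rs l) ^ 2 / (2 * α)

/-- A lower bound for the rate at which the Lyapunov function decays. The terms measure the strict
concavity of the utilities and of the entropy. -/
noncomputable def dissipation (Gc : SimpleGraph E) (β k : ℝ) (xs : S → ℝ) (rs : E → ℝ)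
    (z : (S → ℝ) × (E → ℝ)) : ℝ :=
  ∑ s, 2 * k ^ 2 * ((z.1 s - xs s) ^ 2 * (z.1 s + xs s) / (z.1 s ^ 2 * xs s ^ 2)) +
    ∑ l, (z.2 l - rs l) *
      (linkService Gc (gibbs Gc β z.2) l - linkService Gc (gibbs Gc β rs) l)

lemma sub_one_sub_log_nonneg {w : ℝ} (hw : 0 < w) : 0 ≤ w - 1 - Real.log w := by
  linarith [Real.log_le_sub_one_of_pos hw]

lemma lyapunov_rate_nonneg {k : ℝ} (hk : 0 < k) {T : S → ℝ} (hT : ∀ s, 0 < T s) {xs x : S → ℝ}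
    {s : S} (hxs : 0 < xs s) (hx : 0 < x s) :
    0 ≤ 2 * connections k T s * (xs s / x s - 1 - Real.log (xs s / x s)) := by
  have := mul_pos hk (hT s)
  exact mul_nonneg (by unfold connections; linarith) (sub_one_sub_log_nonneg (div_pos hxs hx))

lemma lyapunov_self (α k : ℝ) (T : S → ℝ) {xs : S → ℝ} (rs : E → ℝ) (hxs : ∀ s, 0 < xs s) :
    lyapunov α k T xs rs (xs, rs) = 0 := by
  simp [lyapunov, fun s => div_self (hxs s).ne']

lemma lyapunov_nonneg {α k : ℝ} (hα : 0 < α) (hk : 0 < k) {T : S → ℝ} (hT : ∀ s, 0 < T s)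
    {xs : S → ℝ} (rs : E → ℝ) (hxs : ∀ s, 0 < xs s) {z : (S → ℝ) × (E → ℝ)}
    (hz : ∀ s, 0 < z.1 s) : 0 ≤ lyapunov α k T xs rs z :=
  add_nonneg (Finset.sum_nonneg fun s _ => lyapunov_rate_nonneg hk hT (hxs s) (hz s))
    (Finset.sum_nonneg fun l _ => by positivity)

lemma lyapunov_pos {α k : ℝ} (hα : 0 < α) (hk : 0 < k) {T : S → ℝ} (hT : ∀ s, 0 < T s)
    {xs : S → ℝ} {rs : E → ℝ} (hxs : ∀ s, 0 < xs s) {z : (S → ℝ) × (E → ℝ)}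
    (hz : ∀ s, 0 < z.1 s) (hne : z ≠ (xs, rs)) : 0 < lyapunov α k T xs rs z := by
  have h1 : ∀ s ∈ Finset.univ, 0 ≤ 2 * connections k T s *
      (xs s / z.1 s - 1 - Real.log (xs s / z.1 s)) :=
    fun s _ => lyapunov_rate_nonneg hk hT (hxs s) (hz s)
  have h2 : ∀ l ∈ Finset.univ, 0 ≤ (z.2 l - rs l) ^ 2 / (2 * α) := fun l _ => by positivity
  have h1' := Finset.sum_nonneg h1
  have h2' := Finset.sum_nonneg h2
  refine (add_nonneg h1' h2').lt_of_ne fun h0 => hne (Prod.ext ?_ ?_)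
  · funext s
    have := (Finset.sum_eq_zero_iff_of_nonneg h1).1 (by linarith) s (Finset.mem_univ s)
    have hn : 0 < connections k T s := mul_pos hk (hT s)
    by_contra hne
    have hw : xs s / z.1 s ≠ 1 := fun h => hne ((div_eq_one_iff_eq (hz s).ne').1 h).symm
    have := Real.log_lt_sub_one_of_pos (div_pos (hxs s) (hz s)) hw
    have : 0 < 2 * connections k T s * (xs s / z.1 s - 1 - Real.log (xs s / z.1 s)) :=
      mul_pos (by linarith) (by linarith)
    linarith
  · funext l
    have := (Finset.sum_eq_zero_iff_of_nonneg h2).1 (by linarith) l (Finset.mem_univ l)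
    rw [div_eq_zero_iff, or_iff_left (by positivity)] at this
    exact sub_eq_zero.1 (pow_eq_zero_iff two_ne_zero |>.1 this)

lemma continuousOn_lyapunov (α k : ℝ) (T : S → ℝ) {xs : S → ℝ} (rs : E → ℝ)
    (hxs : ∀ s, 0 < xs s) :
    ContinuousOn (lyapunov α k T xs rs) {z | ∀ s, 0 < z.1 s} := by
  unfold lyapunov
  refine ContinuousOn.add (continuousOn_finsetSum _ fun s _ => ?_) (by fun_prop)
  have h : ContinuousOn (fun z : (S → ℝ) × (E → ℝ) => xs s / z.1 s) {z | ∀ s, 0 < z.1 s} :=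
    continuousOn_const.div (by fun_prop) fun z hz => (hz s).ne'
  exact continuousOn_const.mul ((h.sub continuousOn_const).sub
    (h.log fun z hz => (div_pos (hxs s) (hz s)).ne'))

/-- The gradient of the log-partition function is strictly monotone: the sum below is a symmetrized
Kullback–Leibler divergence. -/
lemma sum_linkService_sub (Gc : SimpleGraph E) (β : ℝ) (r r' : E → ℝ) :
    β * ∑ l, (r l - r' l) *
        (linkService Gc (gibbs Gc β r) l - linkService Gc (gibbs Gc β r') l) =
      ∑ i, (gibbs Gc β r i - gibbs Gc β r' i) *
        (Real.log (gibbs Gc β r i) - Real.log (gibbs Gc β r' i)) := by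
  have e : ∑ l, (r l - r' l) *
      (linkService Gc (gibbs Gc β r) l - linkService Gc (gibbs Gc β r') l) =
      ∑ i : Schedule Gc, (gibbs Gc β r i - gibbs Gc β r' i) * ∑ l ∈ i.1, (r l - r' l) := by
    simp_rw [mul_sub (r _ - r' _)]
    rw [Finset.sum_sub_distrib, sum_mul_linkService Gc _ fun l => r l - r' l,
      sum_mul_linkService Gc _ fun l => r l - r' l, ← Finset.sum_sub_distrib]
    exact Finset.sum_congr rfl fun i _ => (sub_mul _ _ _).symm
  have hlog : ∀ i : Schedule Gc, Real.log (gibbs Gc β r i) - Real.log (gibbs Gc β r' i) =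
      β * (∑ l ∈ i.1, (r l - r' l)) +
        (Real.log (∑ j : Schedule Gc, Real.exp (∑ l ∈ j.1, β * r' l)) -
          Real.log (∑ j : Schedule Gc, Real.exp (∑ l ∈ j.1, β * r l))) := by
    intro i
    rw [log_gibbs, log_gibbs, Finset.sum_sub_distrib]
    ring
  have h0 : ∑ i, (gibbs Gc β r i - gibbs Gc β r' i) = 0 := by
    rw [Finset.sum_sub_distrib, sum_gibbs, sum_gibbs, sub_self]
  simp_rw [e, hlog, mul_add, Finset.sum_add_distrib, ← Finset.sum_mul, h0, zero_mul, add_zero,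
    Finset.mul_sum Finset.univ _ β]
  exact Finset.sum_congr rfl fun i _ => mul_left_comm _ _ _

lemma sub_mul_log_sub_pos {a b : ℝ} (ha : 0 < a) (hb : 0 < b) (hab : a ≠ b) :
    0 < (a - b) * (Real.log a - Real.log b) := by
  rcases lt_or_gt_of_ne hab with h | h
  · exact mul_pos_of_neg_of_neg (sub_neg.2 h) (sub_neg.2 (Real.log_lt_log ha h))
  · exact mul_pos (sub_pos.2 h) (sub_pos.2 (Real.log_lt_log hb h))

lemma sum_linkService_sub_pos (Gc : SimpleGraph E) {β : ℝ} (hβ : 0 < β) {r r' : E → ℝ}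
    (hne : r ≠ r') : 0 < ∑ l, (r l - r' l) *
        (linkService Gc (gibbs Gc β r) l - linkService Gc (gibbs Gc β r') l) := by
  refine (mul_pos_iff_of_pos_left hβ).1 ?_
  rw [sum_linkService_sub]
  obtain ⟨i, hi⟩ := Function.ne_iff.1 ((gibbs_injective Gc hβ).ne hne)
  refine Finset.sum_pos' (fun j _ => ?_) ⟨i, Finset.mem_univ i,
    sub_mul_log_sub_pos (gibbs_pos Gc β r i) (gibbs_pos Gc β r' i) hi⟩
  by_cases h : gibbs Gc β r j = gibbs Gc β r' j
  · simp [h]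
  · exact (sub_mul_log_sub_pos (gibbs_pos Gc β r j) (gibbs_pos Gc β r' j) h).le

lemma dissipation_pos (Gc : SimpleGraph E) {β k : ℝ} (hβ : 0 < β) (hk : 0 < k)
    {xs : S → ℝ} {rs : E → ℝ} (hxs : ∀ s, 0 < xs s) {z : (S → ℝ) × (E → ℝ)}
    (hz : ∀ s, 0 < z.1 s) (hne : z ≠ (xs, rs)) : 0 < dissipation Gc β k xs rs z := by
  have h1 : ∀ s, 0 ≤ 2 * k ^ 2 * ((z.1 s - xs s) ^ 2 * (z.1 s + xs s) / (z.1 s ^ 2 * xs s ^ 2)) :=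
    fun s => by have := hz s; have := hxs s; positivity
  by_cases h : z.2 = rs
  · have hx : z.1 ≠ xs := fun h' => hne (Prod.ext h' h)
    obtain ⟨s, hs⟩ := Function.ne_iff.1 hx
    have : 0 < ∑ s, 2 * k ^ 2 * ((z.1 s - xs s) ^ 2 * (z.1 s + xs s) / (z.1 s ^ 2 * xs s ^ 2)) := by
      refine Finset.sum_pos' (fun s _ => h1 s) ⟨s, Finset.mem_univ s, ?_⟩
      have := hz s
      have := hxs s
      have := sub_ne_zero.2 hs
      positivity
    simpa [dissipation, h] using this
  · exact add_pos_of_nonneg_of_pos (Finset.sum_nonneg fun s _ => h1 s)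
      (sum_linkService_sub_pos Gc hβ h)

lemma continuousOn_dissipation (Gc : SimpleGraph E) (β k : ℝ) {xs : S → ℝ} (rs : E → ℝ)
    (hxs : ∀ s, 0 < xs s) :
    ContinuousOn (dissipation Gc β k xs rs) {z | ∀ s, 0 < z.1 s} := by
  have hg : ∀ i, Continuous fun z : (S → ℝ) × (E → ℝ) => gibbs Gc β z.2 i := fun i =>
    (continuous_apply i).comp ((continuous_gibbs Gc β).comp continuous_snd)
  unfold dissipation linkService
  refine ContinuousOn.add (continuousOn_finsetSum _ fun s _ => ?_) (by fun_prop)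
  refine continuousOn_const.mul (ContinuousOn.div (by fun_prop) (by fun_prop) fun z hz => ?_)
  have := hz s
  have := hxs s
  positivity

/-- Along the vector field the Lyapunov function decays at least at the rate `dissipation`: the
projection only helps since `r* ≥ 0`, the bilinear terms in rates and multipliers cancel, and
`(r - r*) (load - service) ≤ 0` at `(x*, r*)` by complementary slackness. -/
lemma lyapunov_deriv_le (Gc : SimpleGraph E) (route : S → Finset E) {α β k : ℝ} (hα : 0 < α)
    (hk : 0 < k) {T : S → ℝ} (hT : ∀ s, 0 < T s) {xs : S → ℝ} {rs : E → ℝ}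
    (heq : IsEquilibrium Gc route α β k T xs rs) {x : S → ℝ} {r : E → ℝ} (hst : IsState x r) :
    ∑ s, 2 * connections k T s * ((x s - xs s) / x s ^ 2) * rateField route k T x r s +
        ∑ l, (r l - rs l) / α * aggrField Gc route α β x r l ≤
      -dissipation Gc β k xs rs (x, r) := by
  obtain ⟨hs, hx, hr⟩ := (isEquilibrium_iff Gc route hα hk hT xs rs).1 heq
  have h1 : ∀ s, 2 * connections k T s * ((x s - xs s) / x s ^ 2) * rateField route k T x r s =
      -(2 * k ^ 2 * ((x s - xs s) ^ 2 * (x s + xs s) / (x s ^ 2 * xs s ^ 2))) +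
        (x s * ∑ l ∈ route s, (rs l - r l) - xs s * ∑ l ∈ route s, (rs l - r l)) := by
    intro s
    have p1 := hst.1 s
    have p2 := hs.1 s
    have p3 := hT s
    rw [rateField_eq route hk hT r p1, Finset.sum_sub_distrib,
      show ∑ l ∈ route s, rs l = 2 * k ^ 2 / xs s ^ 2 by
        rw [eq_div_iff (by positivity), ← hx s]; ring]
    unfold connections
    field_simp
    ring
  have h2 : ∀ l, (r l - rs l) / α * aggrField Gc route α β x r l ≤
      (r l - rs l) * (linkLoad route x l - linkLoad route xs l) - (r l - rs l) *
      (linkService Gc (gibbs Gc β r) l - linkService Gc (gibbs Gc β rs) l) := by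
    intro l
    have e : (r l - rs l) / α * aggrField Gc route α β x r l = (r l - rs l) *
        proj (linkLoad route x l - linkService Gc (gibbs Gc β r) l) (r l) := by
      rw [aggrField]; field_simp
    rw [e]
    have p1 : (r l - rs l) * proj (linkLoad route x l - linkService Gc (gibbs Gc β r) l) (r l) ≤
        (r l - rs l) * (linkLoad route x l - linkService Gc (gibbs Gc β r) l) := by
      unfold proj
      split_ifs with h
      · exact mul_le_mul_of_nonpos_left (le_max_left _ _) (by linarith [hs.2 l])
      · exact le_rfl
    have p2 : (r l - rs l) * (linkLoad route xs l - linkService Gc (gibbs Gc β rs) l) ≤ 0 := by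
      rw [sub_mul, (hr l).2, sub_zero]
      exact mul_nonpos_of_nonneg_of_nonpos (hst.2 l) (sub_nonpos.2 (hr l).1)
    linarith
  refine (add_le_add (Finset.sum_congr rfl fun s _ => h1 s).le
    (Finset.sum_le_sum fun l _ => h2 l)).trans (le_of_eq ?_)
  have h3 : ∑ l, (r l - rs l) * (linkLoad route x l - linkLoad route xs l) =
      -(∑ s, (x s * ∑ l ∈ route s, (rs l - r l) - xs s * ∑ l ∈ route s, (rs l - r l))) := by
    rw [Finset.sum_sub_distrib, ← sum_mul_linkLoad, ← sum_mul_linkLoad, ← Finset.sum_sub_distrib,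
      ← Finset.sum_neg_distrib]
    exact Finset.sum_congr rfl fun l _ => by ring
  have h4 : ∑ l, ((r l - rs l) * (linkLoad route x l - linkLoad route xs l) - (r l - rs l) *
      (linkService Gc (gibbs Gc β r) l - linkService Gc (gibbs Gc β rs) l)) =
      ∑ l, (r l - rs l) * (linkLoad route x l - linkLoad route xs l) - ∑ l, (r l - rs l) *
      (linkService Gc (gibbs Gc β r) l - linkService Gc (gibbs Gc β rs) l) :=
    Finset.sum_sub_distrib _ _
  unfold dissipation
  rw [h4, h3, Finset.sum_add_distrib, Finset.sum_neg_distrib]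
  ring

lemma hasDerivAt_lyapunov (α k : ℝ) (T : S → ℝ) {xs : S → ℝ} (rs : E → ℝ)
    (hxs : ∀ s, 0 < xs s) {x : ℝ → S → ℝ} {r : ℝ → E → ℝ} {x' : S → ℝ} {r' : E → ℝ} {t : ℝ}
    (hpos : ∀ s, 0 < x t s) (hx : ∀ s, HasDerivAt (fun u => x u s) (x' s) t)
    (hr : ∀ l, HasDerivAt (fun u => r u l) (r' l) t) :
    HasDerivAt (fun u => lyapunov α k T xs rs (x u, r u))
      (∑ s, 2 * connections k T s * ((x t s - xs s) / x t s ^ 2) * x' s +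
        ∑ l, (r t l - rs l) / α * r' l) t := by
  unfold lyapunov
  refine (HasDerivAt.fun_sum fun s _ => ?_).add (HasDerivAt.fun_sum fun l _ => ?_)
  · have p1 := hpos s
    have p2 := hxs s
    have h := (hasDerivAt_const t (xs s)).fun_div (hx s) p1.ne'
    refine (((h.sub_const 1).sub (h.log (div_pos p2 p1).ne')).const_mul
      (2 * connections k T s)).congr_deriv ?_
    field_simp
    ring
  · refine ((((hr l).sub_const (rs l)).pow 2).div_const (2 * α)).congr_deriv ?_
    simp only [Nat.cast_ofNat, Nat.add_one_sub_one, pow_one]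
    ring

/-! ### Boxes that contain sublevel sets -/

/-- A sublevel set of the Lyapunov function lies strictly inside a box whose rates are bounded
away from zero. -/
lemma exists_box {α k : ℝ} (hα : 0 < α) (hk : 0 < k) {T : S → ℝ} (hT : ∀ s, 0 < T s)
    {xs : S → ℝ} (rs : E → ℝ) (hxs : ∀ s, 0 < xs s) {c : ℝ} (hc : 0 ≤ c) :
    ∃ (m M : S → ℝ) (R : E → ℝ), (∀ s, 0 < m s) ∧ ∀ z : (S → ℝ) × (E → ℝ), (∀ s, 0 < z.1 s) →
      lyapunov α k T xs rs z ≤ c → (∀ s, m s < z.1 s ∧ z.1 s < M s) ∧ ∀ l, z.2 l < R l := by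
  set C : S → ℝ := fun s => c / (2 * connections k T s) with hC
  have hn : ∀ s, 0 < connections k T s := fun s => mul_pos hk (hT s)
  have hC0 : ∀ s, 0 ≤ C s := fun s => by have := hn s; positivity
  refine ⟨fun s => xs s / (2 * C s + 3), fun s => xs s * Real.exp (C s + 2),
    fun l => rs l + (2 * α * c + 1), fun s => div_pos (hxs s) (by linarith [hC0 s]),
    fun z hz hV => ⟨fun s => ?_, fun l => ?_⟩⟩
  all_goals
    have h1 : ∀ s ∈ Finset.univ, 0 ≤ 2 * connections k T s *
        (xs s / z.1 s - 1 - Real.log (xs s / z.1 s)) :=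
      fun s _ => lyapunov_rate_nonneg hk hT (hxs s) (hz s)
    have h2 : ∀ l ∈ Finset.univ, 0 ≤ (z.2 l - rs l) ^ 2 / (2 * α) := fun l _ => by positivity
    have h1' := Finset.sum_nonneg h1
    have h2' := Finset.sum_nonneg h2
    unfold lyapunov at hV
  · have h3 := (Finset.single_le_sum h1 (Finset.mem_univ s)).trans (by linarith : _ ≤ c)
    rw [mul_comm, ← le_div_iff₀ (by linarith [hn s])] at h3
    have hz := hz s
    have hw : 0 < xs s / z.1 s := div_pos (hxs s) hz
    have h3 : xs s / z.1 s - 1 - Real.log (xs s / z.1 s) ≤ C s := h3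
    constructor
    · have h4 := Real.log_le_sub_one_of_pos (half_pos hw)
      rw [Real.log_div hw.ne' two_ne_zero] at h4
      have h5 : Real.log 2 ≤ 1 := by linarith [Real.log_two_lt_d9]
      rw [div_lt_comm₀ (by linarith [hC0 s]) hz]
      linarith
    · have h4 : Real.exp (-(C s + 2)) < xs s / z.1 s :=
        (Real.lt_log_iff_exp_lt hw).1 (by linarith)
      rw [Real.exp_neg, lt_div_iff₀ hz, inv_mul_lt_iff₀ (Real.exp_pos _)] at h4
      linarith
  · have h3 := (Finset.single_le_sum h2 (Finset.mem_univ l)).trans (by linarith : _ ≤ c)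
    rw [div_le_iff₀ (by positivity)] at h3
    by_contra! h
    have : 0 ≤ α * c := by positivity
    nlinarith

/-- The Lyapunov function is locally absolutely continuous along a curve inside a box. -/
lemma absolutelyContinuousOnInterval_lyapunov (α k : ℝ) (T : S → ℝ) {xs : S → ℝ} (rs : E → ℝ)
    (hxs : ∀ s, 0 < xs s) {m M : S → ℝ} (hm : ∀ s, 0 < m s) {x : ℝ → S → ℝ} {r : ℝ → E → ℝ}
    {a b : ℝ} (hx : ∀ s, AbsolutelyContinuousOnInterval (fun t => x t s) a b)
    (hr : ∀ l, AbsolutelyContinuousOnInterval (fun t => r t l) a b)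
    (hbox : ∀ t ∈ Set.uIcc a b, ∀ s, x t s ∈ Set.Icc (m s) (M s)) :
    AbsolutelyContinuousOnInterval (fun t => lyapunov α k T xs rs (x t, r t)) a b := by
  have hconst : ∀ c : ℝ, AbsolutelyContinuousOnInterval (fun _ => c) a b := fun c =>
    (LipschitzWith.const c).lipschitzOnWith.absolutelyContinuousOnInterval
  unfold lyapunov
  refine (AbsolutelyContinuousOnInterval.finset_sum _ fun s _ => ?_).fun_add
    (AbsolutelyContinuousOnInterval.finset_sum _ fun l _ => ?_)
  · have hsmooth : ContDiffOn ℝ 1 (fun y => 2 * connections k T s *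
        (xs s / y - 1 - Real.log (xs s / y))) (Set.Icc (m s) (M s)) := by
      have h : ContDiffOn ℝ 1 (fun y => xs s / y) (Set.Icc (m s) (M s)) :=
        contDiffOn_const.div contDiffOn_id fun y hy => ((hm s).trans_le hy.1).ne'
      exact contDiffOn_const.mul ((h.sub contDiffOn_const).sub
        (h.log fun y hy => (div_pos (hxs s) ((hm s).trans_le hy.1)).ne'))
    obtain ⟨K, hK⟩ := hsmooth.exists_lipschitzOnWith (by decide) (convex_Icc _ _) isCompact_Icc
    exact hK.comp_absolutelyContinuousOnInterval (hx s) fun t ht => hbox t ht s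
  · have h := (hr l).fun_sub (hconst (rs l))
    have := (h.fun_mul h).const_mul (1 / (2 * α))
    refine (congrArg (fun f => AbsolutelyContinuousOnInterval f a b) ?_).mp this
    funext t
    ring

/-! ### Decay of the Lyapunov function along solutions -/

/-- A curve with nonnegative `r` that solves the system at almost every time it spends in `B`. A
trajectory does so for every `B`; for a compact `B` the notion also covers the solutions of a system
that is modified outside `B`. -/
def SolvesWithin (Gc : SimpleGraph E) (route : S → Finset E) (α β k : ℝ) (T : S → ℝ)
    (B : Set ((S → ℝ) × (E → ℝ))) (x : ℝ → S → ℝ) (r : ℝ → E → ℝ) : Prop :=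
  (∀ t, 0 ≤ t → ∀ l, 0 ≤ r t l) ∧
    (∀ b, 0 ≤ b → (∀ s, AbsolutelyContinuousOnInterval (fun t => x t s) 0 b) ∧
      ∀ l, AbsolutelyContinuousOnInterval (fun t => r t l) 0 b) ∧
    ∀ᵐ t ∂(volume.restrict (Set.Ici (0 : ℝ))), (x t, r t) ∈ B →
      (∀ s, HasDerivAt (fun u => x u s) (rateField route k T (x t) (r t) s) t) ∧
        ∀ l, HasDerivAt (fun u => r u l) (aggrField Gc route α β (x t) (r t) l) t

lemma IsTrajectory.solvesWithin {Gc : SimpleGraph E} {route : S → Finset E} {α β k : ℝ}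
    {T : S → ℝ} (hα : 0 < α) {x : ℝ → S → ℝ} {r : ℝ → E → ℝ}
    (h : IsTrajectory Gc route α β k T x r) (B : Set ((S → ℝ) × (E → ℝ))) :
    SolvesWithin Gc route α β k T B x r := by
  refine ⟨fun t ht l => ?_, h.2.1, h.2.2.mono fun t ht _ => ht⟩
  refine ((h.2.1 t ht).2 l).nonneg ht (h.1.2 l) ?_
  filter_upwards [(ae_restrict_iff' measurableSet_Ici).1 h.2.2] with u hu hut
  refine ⟨_, (hu hut.1.le).2 l, fun hneg => ?_⟩
  rw [aggrField, proj, if_pos hneg]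
  exact mul_nonneg hα.le (le_max_right _ _)

section Decay

variable {Gc : SimpleGraph E} {route : S → Finset E} {α β k : ℝ} {T : S → ℝ}
  {xs : S → ℝ} {rs : E → ℝ} {m M : S → ℝ} {R : E → ℝ} {x : ℝ → S → ℝ} {r : ℝ → E → ℝ}

lemma box_subset (hm : ∀ s, 0 < m s) :
    Set.Icc (m, (0 : E → ℝ)) (M, R) ⊆ {z | ∀ s, 0 < z.1 s} :=
  fun _ hz s => (hm s).trans_le (hz.1.1 s)

/-- While a solution is inside the box, the Lyapunov function decays at least as fast as any lower
bound of the dissipation says. -/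
lemma SolvesWithin.lyapunov_sub_le (hα : 0 < α) (hk : 0 < k) (hT : ∀ s, 0 < T s)
    (heq : IsEquilibrium Gc route α β k T xs rs) (hm : ∀ s, 0 < m s)
    (h : SolvesWithin Gc route α β k T (Set.Icc (m, 0) (M, R)) x r) {a b C : ℝ} (ha : 0 ≤ a)
    (hab : a ≤ b) (hbox : ∀ t ∈ Set.Icc a b, (x t, r t) ∈ Set.Icc (m, 0) (M, R))
    (hC : ∀ t ∈ Set.Icc a b, C ≤ dissipation Gc β k xs rs (x t, r t)) :
    lyapunov α k T xs rs (x b, r b) - lyapunov α k T xs rs (x a, r a) ≤ -C * (b - a) := by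
  have hsub : Set.uIcc a b ⊆ Set.uIcc 0 b := by
    rw [Set.uIcc_of_le hab, Set.uIcc_of_le (ha.trans hab)]
    exact Set.Icc_subset_Icc_left ha
  have hac := h.2.1 b (ha.trans hab)
  refine (absolutelyContinuousOnInterval_lyapunov α k T rs heq.1.1 hm
    (fun s => (hac.1 s).mono hsub) (fun l => (hac.2 l).mono hsub)
    (M := M) fun t ht s => ?_).sub_le_mul_sub hab ?_
  · rw [Set.uIcc_of_le hab] at ht
    exact ⟨(hbox t ht).1.1 s, (hbox t ht).2.1 s⟩
  · filter_upwards [(ae_restrict_iff' measurableSet_Ici).1 h.2.2] with t ht htab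
    have htI := Set.Ioo_subset_Icc_self htab
    have hb := hbox t htI
    obtain ⟨hx, hr⟩ := ht (ha.trans htab.1.le) hb
    have hpos : ∀ s, 0 < x t s := box_subset hm hb
    refine ⟨_, hasDerivAt_lyapunov α k T rs heq.1.1 hpos hx hr, ?_⟩
    exact (lyapunov_deriv_le Gc route hα hk hT heq
      ⟨hpos, h.1 t (ha.trans htab.1.le)⟩).trans (neg_le_neg (hC t htI))

lemma dissipation_nonneg (hβ : 0 < β) (hk : 0 < k) (hxs : ∀ s, 0 < xs s)
    {z : (S → ℝ) × (E → ℝ)} (hz : ∀ s, 0 < z.1 s) : 0 ≤ dissipation Gc β k xs rs z := by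
  by_cases h : z = (xs, rs)
  · simp [h, dissipation]
  · exact (dissipation_pos Gc hβ hk hxs hz h).le

/-- A solution cannot leave a box around the sublevel set in which it starts: up to a first exit
time the Lyapunov function does not increase, so the solution is in the interior of the box. In
particular the rates stay positive. -/
lemma SolvesWithin.mem_box (hα : 0 < α) (hβ : 0 < β) (hk : 0 < k) (hT : ∀ s, 0 < T s)
    (heq : IsEquilibrium Gc route α β k T xs rs) (hm : ∀ s, 0 < m s)
    (h : SolvesWithin Gc route α β k T (Set.Icc (m, 0) (M, R)) x r) (h0 : ∀ s, 0 < x 0 s)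
    (hsub : ∀ z : (S → ℝ) × (E → ℝ), (∀ s, 0 < z.1 s) →
      lyapunov α k T xs rs z ≤ lyapunov α k T xs rs (x 0, r 0) →
        (∀ s, m s < z.1 s ∧ z.1 s < M s) ∧ ∀ l, z.2 l < R l) {b : ℝ} (hb : 0 ≤ b) :
    (x b, r b) ∈ Set.Icc (m, 0) (M, R) := by
  have hcx : ∀ s, ContinuousOn (fun t => x t s) (Set.Icc 0 b) := fun s => by
    simpa [Set.uIcc_of_le hb] using ((h.2.1 b hb).1 s).continuousOn
  have hcr : ∀ l, ContinuousOn (fun t => r t l) (Set.Icc 0 b) := fun l => by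
    simpa [Set.uIcc_of_le hb] using ((h.2.1 b hb).2 l).continuousOn
  have hcz : ContinuousOn (fun t => (x t, r t)) (Set.Icc 0 b) :=
    (continuousOn_pi.2 hcx).prodMk (continuousOn_pi.2 hcr)
  have hclosed := hcz.preimage_isClosed_of_isClosed isClosed_Icc
    (isClosed_Icc (a := (m, (0 : E → ℝ))) (b := (M, R)))
  rw [Set.inter_comm] at hclosed
  have hin : ∀ t, 0 ≤ t → (∀ s, m s < x t s ∧ x t s < M s) ∧ (∀ l, r t l < R l) →
      (x t, r t) ∈ Set.Icc (m, 0) (M, R) := fun t ht hz =>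
    ⟨⟨fun s => (hz.1 s).1.le, h.1 t ht⟩, ⟨fun s => (hz.1 s).2.le, fun l => (hz.2 l).le⟩⟩
  refine hclosed.Icc_subset_of_forall_mem_nhdsGT_of_Icc_subset ?_ ?_
    (Set.right_mem_Icc.2 hb)
  · exact hin 0 le_rfl (hsub _ h0 le_rfl)
  · intro t ht hts
    have hV := h.lyapunov_sub_le hα hk hT heq hm (C := 0) le_rfl ht.1 hts fun u hu =>
      dissipation_nonneg hβ hk heq.1.1 (box_subset hm (hts hu))
    have hz := hsub (x t, r t) (box_subset hm (hts (Set.right_mem_Icc.2 ht.1))) (by linarith)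
    have hle : 𝓝[>] t ≤ 𝓝[Set.Icc 0 b] t := by
      rw [← nhdsWithin_Ioo_eq_nhdsGT ht.2]
      exact nhdsWithin_mono _ fun u hu => ⟨ht.1.trans hu.1.le, hu.2.le⟩
    have htI : t ∈ Set.Icc 0 b := ⟨ht.1, ht.2.le⟩
    have e1 : ∀ᶠ u in 𝓝[>] t, ∀ s, m s < x u s ∧ x u s < M s :=
      eventually_all.2 fun s => (((hcx s t htI).mono_left hle).eventually_const_lt (hz.1 s).1).and
        (((hcx s t htI).mono_left hle).eventually_lt_const (hz.1 s).2)
    have e2 : ∀ᶠ u in 𝓝[>] t, ∀ l, r u l < R l :=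
      eventually_all.2 fun l => ((hcr l t htI).mono_left hle).eventually_lt_const (hz.2 l)
    filter_upwards [e1, e2, self_mem_nhdsWithin] with u h1 h2 hu
    exact hin u (ht.1.trans (le_of_lt hu)) ⟨h1, h2⟩

/-- States at which the Lyapunov function is small are close to the equilibrium. -/
lemma exists_dist_lt_of_lyapunov_lt (hα : 0 < α) (hk : 0 < k) (hT : ∀ s, 0 < T s)
    (hxs : ∀ s, 0 < xs s) {ε : ℝ} (hε : 0 < ε) :
    ∃ η > 0, ∀ z : (S → ℝ) × (E → ℝ), (∀ s, 0 < z.1 s) → (∀ l, 0 ≤ z.2 l) →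
      lyapunov α k T xs rs z < η → dist z (xs, rs) < ε := by
  obtain ⟨m, M, R, hm, hbox⟩ := exists_box hα hk hT rs hxs zero_le_one
  have hK : IsCompact (Set.Icc (m, (0 : E → ℝ)) (M, R) ∩ {z | ε ≤ dist z (xs, rs)}) :=
    isCompact_Icc.inter_right (isClosed_le continuous_const (by fun_prop))
  obtain ⟨η, hη, hmin⟩ := hK.exists_forall_le'
    ((continuousOn_lyapunov α k T rs hxs).mono (Set.inter_subset_left.trans (box_subset hm)))
    (a := 0) fun z hz => lyapunov_pos hα hk hT hxs (box_subset hm hz.1) fun h => by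
      have := hz.2
      simp only [Set.mem_ofPred_eq, h, dist_self] at this
      exact this.not_gt hε
  refine ⟨min η 1, lt_min hη one_pos, fun z hz hr hV => ?_⟩
  by_contra! hd
  obtain ⟨h1, h2⟩ := hbox z hz (hV.le.trans (min_le_right _ _))
  exact ((hmin z ⟨⟨⟨fun s => (h1 s).1.le, hr⟩, ⟨fun s => (h1 s).2.le, fun l => (h2 l).le⟩⟩,
    hd⟩).trans_lt (hV.trans_le (min_le_left _ _))).false

lemma IsTrajectory.lyapunov_antitoneOn (hα : 0 < α) (hβ : 0 < β) (hk : 0 < k)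
    (hT : ∀ s, 0 < T s) (heq : IsEquilibrium Gc route α β k T xs rs)
    (h : IsTrajectory Gc route α β k T x r) :
    (∀ t, 0 ≤ t → IsState (x t) (r t)) ∧
      AntitoneOn (fun t => lyapunov α k T xs rs (x t, r t)) (Set.Ici 0) ∧
      ∀ η > 0, ∃ t, 0 ≤ t ∧ lyapunov α k T xs rs (x t, r t) < η := by
  obtain ⟨m, M, R, hm, hsub⟩ := exists_box hα hk hT rs heq.1.1
    (lyapunov_nonneg hα hk hT rs heq.1.1 (z := (x 0, r 0)) h.1.1)
  have hs := h.solvesWithin hα (Set.Icc (m, 0) (M, R))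
  have hbox : ∀ t, 0 ≤ t → (x t, r t) ∈ Set.Icc (m, 0) (M, R) := fun t ht =>
    hs.mem_box hα hβ hk hT heq hm h.1.1 hsub ht
  have hpos : ∀ t, 0 ≤ t → ∀ s, 0 < x t s := fun t ht => box_subset hm (hbox t ht)
  refine ⟨fun t ht => ⟨hpos t ht, hs.1 t ht⟩, fun a ha b _ hab => ?_, fun η hη => ?_⟩
  · have := hs.lyapunov_sub_le hα hk hT heq hm (C := 0) ha hab
      (fun t ht => hbox t (le_trans ha ht.1))
      fun t ht => dissipation_nonneg hβ hk heq.1.1 (hpos t (le_trans ha ht.1))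
    simp only
    linarith
  · by_contra! hge
    -- On the compact set where the Lyapunov function is at least `η` the dissipation is bounded
    -- away from zero, so the Lyapunov function would become negative in finite time.
    have hK : IsCompact (Set.Icc (m, (0 : E → ℝ)) (M, R) ∩
        lyapunov α k T xs rs ⁻¹' Set.Ici η) :=
      isCompact_Icc.of_isClosed_subset
        (((continuousOn_lyapunov α k T rs heq.1.1).mono
          (box_subset hm)).preimage_isClosed_of_isClosed isClosed_Icc isClosed_Ici)
        Set.inter_subset_left
    obtain ⟨C, hC, hmin⟩ := hK.exists_forall_le'
      ((continuousOn_dissipation Gc β k rs heq.1.1).mono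
        (Set.inter_subset_left.trans (box_subset hm)))
      (a := 0) fun z hz => dissipation_pos Gc hβ hk heq.1.1 (box_subset hm hz.1) fun h => by
        have : η ≤ lyapunov α k T xs rs z := hz.2
        rw [h, lyapunov_self α k T rs heq.1.1] at this
        exact this.not_gt hη
    set V₀ := lyapunov α k T xs rs (x 0, r 0) with hV₀
    have hV₀0 : 0 ≤ V₀ := lyapunov_nonneg hα hk hT rs heq.1.1 h.1.1
    have hb : 0 ≤ V₀ / C := div_nonneg hV₀0 hC.le
    have h1 := hs.lyapunov_sub_le hα hk hT heq hm (C := C) le_rfl hb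
      (fun t ht => hbox t ht.1) fun t ht => hmin _ ⟨hbox t ht.1, hge t ht.1⟩
    have h2 := hge _ hb
    have h3 : -C * (V₀ / C - 0) = -V₀ := by field_simp; ring
    linarith

lemma IsTrajectory.tendsto (hα : 0 < α) (hβ : 0 < β) (hk : 0 < k)
    (hT : ∀ s, 0 < T s) (heq : IsEquilibrium Gc route α β k T xs rs)
    (h : IsTrajectory Gc route α β k T x r) :
    Tendsto (fun t => (x t, r t)) atTop (𝓝 (xs, rs)) := by
  obtain ⟨hst, hanti, hsmall⟩ := h.lyapunov_antitoneOn hα hβ hk hT heq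
  refine Metric.tendsto_atTop.2 fun ε hε => ?_
  obtain ⟨η, hη, hclose⟩ := exists_dist_lt_of_lyapunov_lt (rs := rs) hα hk hT heq.1.1 hε
  obtain ⟨t₀, ht₀, hV⟩ := hsmall η hη
  refine ⟨t₀, fun t ht => hclose _ (hst t (ht₀.trans ht)).1 (hst t (ht₀.trans ht)).2 ?_⟩
  exact (hanti ht₀ (ht₀.trans ht) ht).trans_lt hV

variable (Gc route α β k T) in
lemma lyapunov_stable (hα : 0 < α) (hβ : 0 < β) (hk : 0 < k)
    (hT : ∀ s, 0 < T s) (heq : IsEquilibrium Gc route α β k T xs rs) {ε : ℝ} (hε : 0 < ε) :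
    ∃ δ > 0, ∀ x r, IsTrajectory Gc route α β k T x r →
      dist (x 0, r 0) (xs, rs) < δ → ∀ t, 0 ≤ t → dist (x t, r t) (xs, rs) < ε := by
  obtain ⟨η, hη, hclose⟩ := exists_dist_lt_of_lyapunov_lt (rs := rs) hα hk hT heq.1.1 hε
  have hopen : IsOpen {z : (S → ℝ) × (E → ℝ) | ∀ s, 0 < z.1 s} := by
    simp only [Set.ofPred_forall]
    exact isOpen_iInter_of_finite fun s => isOpen_lt continuous_const (by fun_prop)
  have hcont := (continuousOn_lyapunov α k T rs heq.1.1).continuousAt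
    (hopen.mem_nhds (show (xs, rs) ∈ _ from heq.1.1))
  obtain ⟨δ, hδ, hnear⟩ := Metric.eventually_nhds_iff.1
    (hcont.tendsto.eventually_lt_const
      (show lyapunov α k T xs rs (xs, rs) < η by rwa [lyapunov_self α k T rs heq.1.1]))
  refine ⟨δ, hδ, fun x r h hd t ht => ?_⟩
  obtain ⟨hst, hanti, -⟩ := h.lyapunov_antitoneOn hα hβ hk hT heq
  exact hclose _ (hst t ht).1 (hst t ht).2 ((hanti (Set.mem_Ici.2 le_rfl) ht ht).trans_lt (hnear hd))

end Decay

/-! ### A Picard theorem for causal integral equations -/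

/-- If `G` is bounded and depends on the past of a curve in a Lipschitz way, then the equation
`y' = G y` has a global solution with given initial value. The integral operator is a contraction
for the sup norm weighted by `exp (-c t)`, once `c` is large compared to the Lipschitz constant. -/
theorem exists_eq_add_integral {X : Type*} [NormedAddCommGroup X] [NormedSpace ℝ X]
    [CompleteSpace X] (G : (ℝ → X) → ℝ → X) (hG : ∀ y, Continuous y → Continuous (G y))
    {C L : ℝ} (hL0 : 0 ≤ L) (hC : ∀ y t, ‖G y t‖ ≤ C)
    (hL : ∀ y₁ y₂ : ℝ → X, Continuous y₁ → Continuous y₂ → ∀ t D, 0 ≤ t →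
      (∀ s ∈ Set.Icc 0 t, ‖y₁ s - y₂ s‖ ≤ D) → ‖G y₁ t - G y₂ t‖ ≤ L * D) (z₀ : X) :
    ∃ y : ℝ → X, Continuous y ∧ ∀ t, 0 ≤ t → y t = z₀ + ∫ s in (0 : ℝ)..t, G y s := by
  set c : ℝ := 2 * L + 1 with hc
  have hc0 : 0 < c := by linarith
  let Y : BoundedContinuousFunction ℝ X → ℝ → X := fun u t => Real.exp (c * t) • u t
  have hY : ∀ u, Continuous (Y u) := fun u => by
    have := u.continuous
    fun_prop
  have hint : ∀ u a b, IntervalIntegrable (G (Y u)) volume a b := fun u a b =>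
    (hG _ (hY u)).intervalIntegrable a b
  have hC0 : 0 ≤ C := (norm_nonneg _).trans (hC (fun _ => 0) 0)
  let Φ : BoundedContinuousFunction ℝ X → BoundedContinuousFunction ℝ X := fun u =>
    BoundedContinuousFunction.ofNormedAddCommGroup
      (fun t => Real.exp (-(c * max t 0)) • (z₀ + ∫ s in (0 : ℝ)..max t 0, G (Y u) s))
      (by
        have h : Continuous fun t : ℝ => ∫ s in (0 : ℝ)..t, G (Y u) s :=
          intervalIntegral.continuous_primitive (hint u) 0
        have h' : Continuous fun t : ℝ => ∫ s in (0 : ℝ)..max t 0, G (Y u) s :=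
          h.comp (continuous_id.max continuous_const)
        fun_prop)
      (‖z₀‖ + C / c)
      (by
        intro t
        set p := max t 0 with hp
        have hp0 : 0 ≤ p := le_max_right _ _
        have h1 : ‖∫ s in (0 : ℝ)..p, G (Y u) s‖ ≤ C * p := by
          have := intervalIntegral.norm_integral_le_of_norm_le_const
            (f := G (Y u)) (a := 0) (b := p) fun s _ => hC (Y u) s
          rwa [sub_zero, abs_of_nonneg hp0] at this
        rw [norm_smul, Real.norm_of_nonneg (Real.exp_pos _).le]
        have h2 : Real.exp (-(c * p)) ≤ 1 := Real.exp_le_one_iff.2 (by nlinarith)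
        have h3 : Real.exp (-(c * p)) * p ≤ 1 / c := by
          rw [Real.exp_neg, inv_mul_le_iff₀ (Real.exp_pos _), mul_one_div, le_div_iff₀ hc0]
          linarith [Real.add_one_le_exp (c * p)]
        calc Real.exp (-(c * p)) * ‖z₀ + ∫ s in (0 : ℝ)..p, G (Y u) s‖
            ≤ Real.exp (-(c * p)) * (‖z₀‖ + C * p) :=
              mul_le_mul_of_nonneg_left ((norm_add_le _ _).trans (by linarith))
                (Real.exp_pos _).le
          _ = Real.exp (-(c * p)) * ‖z₀‖ + C * (Real.exp (-(c * p)) * p) := by ring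
          _ ≤ 1 * ‖z₀‖ + C * (1 / c) := by gcongr
          _ = ‖z₀‖ + C / c := by ring)
  have hΦ : ContractingWith (1 / 2) Φ := by
    refine ⟨by norm_num, LipschitzWith.of_dist_le_mul fun u v => ?_⟩
    refine (BoundedContinuousFunction.dist_le (by positivity)).2 fun t => ?_
    change dist (Real.exp (-(c * max t 0)) • (z₀ + ∫ s in (0 : ℝ)..max t 0, G (Y u) s))
      (Real.exp (-(c * max t 0)) • (z₀ + ∫ s in (0 : ℝ)..max t 0, G (Y v) s)) ≤ _
    set p := max t 0 with hp
    have hp0 : 0 ≤ p := le_max_right _ _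
    rw [dist_eq_norm, ← smul_sub, add_sub_add_left_eq_sub,
      ← intervalIntegral.integral_sub (hint u _ _) (hint v _ _), norm_smul,
      Real.norm_of_nonneg (Real.exp_pos _).le]
    have hpt : ∀ s, 0 ≤ s → ‖G (Y u) s - G (Y v) s‖ ≤ L * dist u v * Real.exp (c * s) := by
      intro s hs
      rw [mul_assoc]
      refine hL _ _ (hY u) (hY v) s _ hs fun s' hs' => ?_
      simp only [Y]
      rw [← smul_sub, norm_smul, Real.norm_of_nonneg (Real.exp_pos _).le, mul_comm]
      refine mul_le_mul ?_ (Real.exp_le_exp.2 (mul_le_mul_of_nonneg_left hs'.2 hc0.le))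
        (Real.exp_pos _).le dist_nonneg
      rw [← dist_eq_norm]
      exact u.dist_coe_le_dist s'
    have hI : ∫ s in (0 : ℝ)..p, L * dist u v * Real.exp (c * s) =
        L * dist u v * (Real.exp (c * p) - 1) / c := by
      rw [intervalIntegral.integral_const_mul, intervalIntegral.integral_comp_mul_left _ hc0.ne',
        integral_exp]
      simp
      ring
    have h1 : ‖∫ s in (0 : ℝ)..p, (G (Y u) s - G (Y v) s)‖ ≤
        L * dist u v * (Real.exp (c * p) - 1) / c := by
      rw [← hI]
      refine intervalIntegral.norm_integral_le_of_norm_le hp0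
        (Eventually.of_forall fun s hs => hpt s hs.1.le)
        (Continuous.intervalIntegrable (by fun_prop) _ _)
    have hexp := Real.exp_pos (c * p)
    have hd : 0 ≤ dist u v := dist_nonneg
    calc Real.exp (-(c * p)) * ‖∫ s in (0 : ℝ)..p, (G (Y u) s - G (Y v) s)‖
        ≤ Real.exp (-(c * p)) * (L * dist u v * Real.exp (c * p) / c) := by
          refine mul_le_mul_of_nonneg_left (h1.trans ?_) (Real.exp_pos _).le
          refine div_le_div_of_nonneg_right ?_ hc0.le
          exact mul_le_mul_of_nonneg_left (by linarith) (by positivity)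
      _ = L / c * dist u v := by
          rw [Real.exp_neg]
          field_simp
      _ ≤ 1 / 2 * dist u v := by
          refine mul_le_mul_of_nonneg_right ?_ hd
          rw [div_le_iff₀ hc0]
          linarith
      _ = _ := by simp
  set u := ContractingWith.fixedPoint Φ hΦ with hu
  have hfix : Φ u = u := hΦ.fixedPoint_isFixedPt
  refine ⟨Y u, hY u, fun t ht => ?_⟩
  have h1 : u t = Real.exp (-(c * max t 0)) • (z₀ + ∫ s in (0 : ℝ)..max t 0, G (Y u) s) := by
    conv_lhs => rw [← hfix]
    rfl
  rw [max_eq_left ht] at h1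
  calc Y u t = Real.exp (c * t) • u t := rfl
    _ = _ := by rw [h1, smul_smul, ← Real.exp_add, add_neg_cancel, Real.exp_zero, one_smul]

/-! ### One-dimensional Skorokhod reflection -/

/-- The regulator of the one-dimensional Skorokhod problem, the running maximum
`max_{0 ≤ u ≤ t} (-w u)⁺`. The time `u = θ t` is parametrized by `θ ∈ [0, 1]`. -/
noncomputable def regulator (w : ℝ → ℝ) (t : ℝ) : ℝ :=
  sSup ((fun θ : ℝ => max 0 (-w (θ * t))) '' Set.Icc 0 1)

section Regulator

variable {w : ℝ → ℝ}

lemma continuous_regulator (hw : Continuous w) : Continuous (regulator w) :=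
  isCompact_Icc.continuous_sSup (f := fun t θ => max 0 (-w (θ * t))) (by
    simp only [Function.HasUncurry.uncurry, id]
    fun_prop)

lemma le_regulator_aux (hw : Continuous w) (t : ℝ) {θ : ℝ} (hθ : θ ∈ Set.Icc (0 : ℝ) 1) :
    max 0 (-w (θ * t)) ≤ regulator w t :=
  le_csSup (isCompact_Icc.bddAbove_image (by fun_prop)) (Set.mem_image_of_mem _ hθ)

lemma regulator_nonneg (hw : Continuous w) (t : ℝ) : 0 ≤ regulator w t :=
  (le_max_left _ _).trans (le_regulator_aux hw t (θ := 0) (by simp))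

lemma neg_le_regulator (hw : Continuous w) {t u : ℝ} (hu : u ∈ Set.Icc 0 t) :
    -w u ≤ regulator w t := by
  have h := (le_max_right _ _).trans (le_regulator_aux hw t (θ := u / t)
    ⟨div_nonneg hu.1 (hu.1.trans hu.2), div_le_one_of_le₀ hu.2 (hu.1.trans hu.2)⟩)
  rcases (hu.1.trans hu.2).eq_or_lt with ht | ht
  · have : u = 0 := le_antisymm (hu.2.trans ht.ge) hu.1
    simpa [← ht, this] using h
  · rwa [div_mul_cancel₀ _ ht.ne'] at h

lemma regulator_le {t c : ℝ} (ht : 0 ≤ t) (hc : 0 ≤ c) (h : ∀ u ∈ Set.Icc 0 t, -w u ≤ c) :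
    regulator w t ≤ c := by
  refine csSup_le ((Set.nonempty_Icc.2 zero_le_one).image _) ?_
  rintro _ ⟨θ, hθ, rfl⟩
  exact max_le hc (h _ ⟨mul_nonneg hθ.1 ht, mul_le_of_le_one_left ht hθ.2⟩)

lemma regulator_monotoneOn (hw : Continuous w) : MonotoneOn (regulator w) (Set.Ici 0) :=
  fun _ ha t _ hat => regulator_le ha (regulator_nonneg hw t) fun _ hu =>
    neg_le_regulator hw ⟨hu.1, hu.2.trans hat⟩

lemma regulator_sub_le {v : ℝ → ℝ} (hv : Continuous v) {t D : ℝ} (ht : 0 ≤ t)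
    (h : ∀ u ∈ Set.Icc 0 t, |w u - v u| ≤ D) : regulator w t - regulator v t ≤ D := by
  rw [sub_le_iff_le_add]
  have hD : 0 ≤ D := (abs_nonneg _).trans (h 0 ⟨le_rfl, ht⟩)
  refine regulator_le ht (add_nonneg hD (regulator_nonneg hv t)) fun u hu => ?_
  have := neg_le_regulator hv hu
  have := (abs_le.1 (h u hu)).1
  linarith

lemma abs_regulator_sub_le {v : ℝ → ℝ} (hw : Continuous w) (hv : Continuous v) {t D : ℝ}
    (ht : 0 ≤ t) (h : ∀ u ∈ Set.Icc 0 t, |w u - v u| ≤ D) :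
    |regulator w t - regulator v t| ≤ D := by
  refine abs_sub_le_iff.2 ⟨regulator_sub_le hv ht h, regulator_sub_le hw ht fun u hu => ?_⟩
  rw [abs_sub_comm]
  exact h u hu

/-- While the reflected curve is positive the regulator does not move. -/
lemma regulator_eventuallyEq (hw : Continuous w) {t : ℝ} (ht : 0 < t)
    (hpos : 0 < w t + regulator w t) : ∀ᶠ u in 𝓝 t, regulator w u = regulator w t := by
  obtain ⟨c, hc1, hc2⟩ := exists_between (show -w t < regulator w t by linarith)
  have h1 : ∀ᶠ u in 𝓝 t, -w u < c := hw.neg.continuousAt.eventually_lt_const hc1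
  have h2 : ∀ᶠ u in 𝓝 t, c < regulator w u :=
    (continuous_regulator hw).continuousAt.eventually_const_lt hc2
  obtain ⟨ε, hε, hb⟩ := Metric.eventually_nhds_iff_ball.1 ((h1.and h2).and (lt_mem_nhds ht))
  have key : ∀ a b, a ∈ Metric.ball t ε → b ∈ Metric.ball t ε → a ≤ b →
      regulator w b = regulator w a := by
    intro a b ha hb' hab
    have ha0 := (hb a ha).2.le
    refine le_antisymm ?_ (regulator_monotoneOn hw ha0 (ha0.trans hab) hab)
    refine regulator_le (ha0.trans hab) (regulator_nonneg hw a) fun u hu => ?_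
    rcases le_total u a with hua | hau
    · exact neg_le_regulator hw ⟨hu.1, hua⟩
    · have hmem : u ∈ Metric.ball t ε := by
        rw [Real.ball_eq_Ioo] at ha hb' ⊢
        exact ⟨ha.1.trans_le hau, hu.2.trans_lt hb'.2⟩
      exact (hb u hmem).1.1.le.trans (hb a ha).1.2.le
  filter_upwards [Metric.ball_mem_nhds t hε] with u hu
  rcases le_total u t with h | h
  · exact (key u t hu (Metric.mem_ball_self hε) h).symm
  · exact key t u (Metric.mem_ball_self hε) hu h

variable {g : ℝ → ℝ} {C : NNReal}

lemma lipschitzOnWith_of_eq_integral (hg : Continuous g) (hC : ∀ t, |g t| ≤ C)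
    (h : ∀ t, 0 ≤ t → w t = w 0 + ∫ s in (0 : ℝ)..t, g s) : LipschitzOnWith C w (Set.Ici 0) := by
  refine LipschitzOnWith.of_dist_le_mul fun a ha b hb => ?_
  rw [h a ha, h b hb, dist_add_left, Real.dist_eq, intervalIntegral.integral_interval_sub_left
    (hg.intervalIntegrable _ _) (hg.intervalIntegrable _ _), Real.dist_eq]
  rw [← Real.norm_eq_abs]
  exact intervalIntegral.norm_integral_le_of_norm_le_const fun s _ => hC s

lemma hasDerivAt_of_eq_integral (hg : Continuous g)
    (h : ∀ t, 0 ≤ t → w t = w 0 + ∫ s in (0 : ℝ)..t, g s) {t : ℝ} (ht : 0 < t) :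
    HasDerivAt w (g t) t := by
  refine ((intervalIntegral.integral_hasDerivAt_right (hg.intervalIntegrable 0 t)
    hg.aestronglyMeasurable.stronglyMeasurableAtFilter hg.continuousAt).const_add
      (w 0)).congr_of_eventuallyEq ?_
  filter_upwards [lt_mem_nhds ht] with u hu
  exact h u hu.le

lemma lipschitzOnWith_regulator (hw : Continuous w) (hl : LipschitzOnWith C w (Set.Ici 0)) :
    LipschitzOnWith C (regulator w) (Set.Ici 0) := by
  have key : ∀ a b, 0 ≤ a → a ≤ b → regulator w b ≤ regulator w a + C * (b - a) := by
    intro a b ha hab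
    have hCab : 0 ≤ C * (b - a) := mul_nonneg C.coe_nonneg (sub_nonneg.2 hab)
    refine regulator_le (ha.trans hab) (add_nonneg (regulator_nonneg hw a) hCab) fun u hu => ?_
    rcases le_total u a with hua | hau
    · linarith [neg_le_regulator hw ⟨hu.1, hua⟩]
    · have h1 := neg_le_regulator hw (t := a) (u := a) ⟨ha, le_rfl⟩
      have h2 := hl.dist_le_mul u hu.1 a ha
      rw [Real.dist_eq, Real.dist_eq, abs_of_nonneg (sub_nonneg.2 hau)] at h2
      have h3 := (abs_le.1 h2).1
      have h4 : C * (u - a) ≤ C * (b - a) :=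
        mul_le_mul_of_nonneg_left (by linarith [hu.2]) C.coe_nonneg
      linarith
  refine LipschitzOnWith.of_dist_le_mul fun a ha b hb => ?_
  wlog hab : a ≤ b generalizing a b
  · rw [dist_comm, dist_comm a]
    exact this b hb a ha (le_of_not_ge hab)
  rw [dist_comm, dist_comm a, Real.dist_eq, Real.dist_eq, abs_of_nonneg (sub_nonneg.2 hab),
    abs_of_nonneg (sub_nonneg.2 (regulator_monotoneOn hw ha hb hab))]
  linarith [key a b ha hab]

lemma reflection_nonneg (hw : Continuous w) {t : ℝ} (ht : 0 ≤ t) : 0 ≤ w t + regulator w t := by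
  linarith [neg_le_regulator hw (Set.right_mem_Icc.2 ht)]

/-- The reflection of a curve `w` with `w' = g` solves the projected equation `y' = [g]_y^+`. While
it is positive the regulator is constant. At almost every zero it is differentiable with a minimum
there, so its derivative vanishes, and `g ≤ 0` since the regulator, whose derivative is then `-g`,
is monotone. -/
lemma ae_hasDerivAt_reflection (hw : Continuous w) (hg : Continuous g) (hC : ∀ t, |g t| ≤ C)
    (h : ∀ t, 0 ≤ t → w t = w 0 + ∫ s in (0 : ℝ)..t, g s) :
    ∀ᵐ t ∂(volume.restrict (Set.Ici (0 : ℝ))),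
      HasDerivAt (fun u => w u + regulator w u) (proj (g t) (w t + regulator w t)) t := by
  have hl := lipschitzOnWith_of_eq_integral hg hC h
  rw [ae_restrict_iff' measurableSet_Ici]
  filter_upwards [(lipschitzOnWith_regulator hw hl).ae_differentiableWithinAt_of_mem_real,
    (Set.countable_singleton (0 : ℝ)).ae_notMem volume] with t hd h0 ht0
  have ht : 0 < t := lt_of_le_of_ne ht0 (Ne.symm h0)
  have hw' := hasDerivAt_of_eq_integral hg h ht
  have hd' := ((hd ht0).differentiableAt (Ici_mem_nhds ht)).hasDerivAt
  rcases (reflection_nonneg hw ht0).eq_or_lt with hz | hpos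
  · have hsum := hw'.add hd'
    have hmin : IsLocalMin (w + regulator w) t := by
      filter_upwards [lt_mem_nhds ht] with u hu
      simp only [Pi.add_apply]
      rw [← hz]
      exact reflection_nonneg hw hu.le
    have hzero := hmin.hasDerivAt_eq_zero hsum
    have hmono := nonneg_of_hasDerivAt_of_forall_ge hd' fun u hu =>
      regulator_monotoneOn hw ht0 (ht.le.trans hu) hu
    rw [proj, if_pos hz.ge, max_eq_right (by linarith), ← hzero]
    exact hsum
  · rw [proj, if_neg hpos.not_ge]
    have := ((hasDerivAt_const t (regulator w t)).congr_of_eventuallyEq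
      (regulator_eventuallyEq hw ht hpos))
    exact (hw'.fun_add this).congr_deriv (add_zero _)

end Regulator

/-! ### Existence of solutions -/

/-- The right-hand sides of the system without the projections, multiplied out so that they are
smooth in the whole space. -/
noncomputable def freeField (Gc : SimpleGraph E) (route : S → Finset E) (α β k : ℝ) (T : S → ℝ)
    (z : S ⊕ E → ℝ) : S ⊕ E → ℝ :=
  Sum.elim
    (fun s => (2 * k ^ 2 - z (.inl s) ^ 2 * ∑ l ∈ route s, z (.inr l)) / (2 * connections k T s))
    (fun l => α * (linkLoad route (fun s => z (.inl s)) l -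
      linkService Gc (gibbs Gc β fun l => z (.inr l)) l))

lemma contDiff_freeField (Gc : SimpleGraph E) (route : S → Finset E) (α β k : ℝ) (T : S → ℝ) :
    ContDiff ℝ 1 (freeField Gc route α β k T) := by
  refine contDiff_pi.2 fun i => ?_
  rcases i with s | l
  · simp only [freeField, Sum.elim_inl]
    fun_prop
  · simp only [freeField, Sum.elim_inr, linkLoad, linkService, gibbs]
    refine contDiff_const.mul ((by fun_prop : ContDiff ℝ 1 _).sub (ContDiff.sum fun i _ => ?_))
    exact ContDiff.div (by fun_prop) (by fun_prop) fun z =>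
      (sum_exp_pos Gc β fun l => z (.inr l)).ne'

/-- The projection of `z` to the box `Icc a b`, which is `1`-Lipschitz for the sup norm. -/
def clamp {ι : Type*} (a b z : ι → ℝ) : ι → ℝ := fun i => max (a i) (min (b i) (z i))

lemma clamp_mem {ι : Type*} {a b : ι → ℝ} (hab : a ≤ b) (z : ι → ℝ) :
    clamp a b z ∈ Set.Icc a b :=
  ⟨fun _ => le_max_left _ _, fun i => max_le (hab i) (min_le_left _ _)⟩

lemma clamp_eq_self {ι : Type*} {a b z : ι → ℝ} (hz : z ∈ Set.Icc a b) : clamp a b z = z := by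
  funext i
  rw [clamp, min_eq_right (hz.2 i), max_eq_right (hz.1 i)]

lemma norm_clamp_sub_le {ι : Type*} [Fintype ι] (a b z z' : ι → ℝ) :
    ‖clamp a b z - clamp a b z'‖ ≤ ‖z - z'‖ := by
  refine (pi_norm_le_iff_of_nonneg (norm_nonneg _)).2 fun i => le_trans ?_ (norm_le_pi_norm _ i)
  simp only [clamp, Pi.sub_apply, Real.norm_eq_abs]
  refine (abs_max_sub_max_le_max _ _ _ _).trans ?_
  rw [sub_self, abs_zero, max_eq_right (abs_nonneg _)]
  refine (abs_min_sub_min_le_max _ _ _ _).trans ?_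
  rw [sub_self, abs_zero, max_eq_right (abs_nonneg _)]

/-- Keep the `S`-coordinates of a curve and reflect the `E`-coordinates at zero. -/
noncomputable def reflectRight (y : ℝ → S ⊕ E → ℝ) (t : ℝ) : S ⊕ E → ℝ :=
  Sum.elim (fun s => y t (.inl s)) fun l => y t (.inr l) + regulator (fun u => y u (.inr l)) t

lemma continuous_reflectRight {y : ℝ → S ⊕ E → ℝ} (hy : Continuous y) :
    Continuous (reflectRight y) := by
  have hyi : ∀ i, Continuous fun t => y t i := fun i => (continuous_apply i).comp hy
  refine continuous_pi fun i => ?_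
  rcases i with s | l
  · exact hyi _
  · exact (hyi _).add (continuous_regulator (hyi _))

lemma norm_reflectRight_sub_le {y₁ y₂ : ℝ → S ⊕ E → ℝ} (h₁ : Continuous y₁) (h₂ : Continuous y₂)
    {t D : ℝ} (ht : 0 ≤ t) (hD : ∀ u ∈ Set.Icc 0 t, ‖y₁ u - y₂ u‖ ≤ D) :
    ‖reflectRight y₁ t - reflectRight y₂ t‖ ≤ 2 * D := by
  have hi : ∀ i, ∀ u ∈ Set.Icc 0 t, |y₁ u i - y₂ u i| ≤ D := fun i u hu =>
    (norm_le_pi_norm (y₁ u - y₂ u) i).trans (hD u hu)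
  have htt : t ∈ Set.Icc 0 t := ⟨ht, le_rfl⟩
  have hD0 : 0 ≤ D := (norm_nonneg _).trans (hD t htt)
  refine (pi_norm_le_iff_of_nonneg (by linarith)).2 fun i => ?_
  rcases i with s | l
  · exact (hi _ t htt).trans (by linarith)
  · have h3 := abs_regulator_sub_le ((continuous_apply (Sum.inr l)).comp h₁)
      ((continuous_apply (Sum.inr l)).comp h₂) ht (hi (.inr l))
    have h4 := hi (.inr l) t htt
    simp only [reflectRight, Pi.sub_apply, Sum.elim_inr, Real.norm_eq_abs]
    rw [add_sub_add_comm, two_mul]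
    exact (abs_add_le _ _).trans (add_le_add h4 h3)

/-- Inside a given box of states the system can be solved from any state of the box: the free field
is modified outside the box to become bounded and Lipschitz, and the projection in the equations
for `r` is realized by Skorokhod reflection. -/
lemma exists_solvesWithin (Gc : SimpleGraph E) (route : S → Finset E) {α β k : ℝ} (hα : 0 < α)
    (hk : 0 < k) {T : S → ℝ} (hT : ∀ s, 0 < T s) {m M : S → ℝ} {R : E → ℝ} (hm : ∀ s, 0 < m s)
    {x₀ : S → ℝ} {r₀ : E → ℝ} (h₀ : (x₀, r₀) ∈ Set.Icc (m, 0) (M, R)) :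
    ∃ x r, SolvesWithin Gc route α β k T (Set.Icc (m, 0) (M, R)) x r ∧ x 0 = x₀ ∧ r 0 = r₀ := by
  set a : S ⊕ E → ℝ := Sum.elim m 0 with ha
  set b : S ⊕ E → ℝ := Sum.elim M R with hb
  have hab : a ≤ b := by
    rintro (s | l)
    · exact (h₀.1.1 s).trans (h₀.2.1 s)
    · exact (h₀.1.2 l).trans (h₀.2.2 l)
  set f := freeField Gc route α β k T with hf
  have hfc : ContDiff ℝ 1 f := contDiff_freeField Gc route α β k T
  obtain ⟨K, hK⟩ := hfc.contDiffOn.exists_lipschitzOnWith (by decide) (convex_Icc a b)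
    isCompact_Icc
  obtain ⟨C, hC⟩ := isCompact_Icc.exists_bound_of_continuousOn (s := Set.Icc a b)
    hfc.continuous.continuousOn
  have hcl : ∀ z, clamp a b z ∈ Set.Icc a b := clamp_mem hab
  have hclamp : Continuous (clamp a b) := by
    unfold clamp
    fun_prop
  have hC0 : 0 ≤ C := (norm_nonneg _).trans (hC _ (hcl 0))
  obtain ⟨y, hy, hyint⟩ := exists_eq_add_integral
    (fun y t => f (clamp a b (reflectRight y t)))
    (fun y hy => hfc.continuous.comp (hclamp.comp (continuous_reflectRight hy)))
    (C := C) (L := K * 2) (by positivity) (fun y t => hC _ (hcl _))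
    (fun y₁ y₂ h₁ h₂ t D ht hD => by
      rw [← dist_eq_norm, mul_assoc]
      refine (hK.dist_le_mul _ (hcl _) _ (hcl _)).trans
        (mul_le_mul_of_nonneg_left ?_ K.coe_nonneg)
      rw [dist_eq_norm]
      exact (norm_clamp_sub_le a b _ _).trans (norm_reflectRight_sub_le h₁ h₂ ht hD))
    (Sum.elim x₀ r₀)
  set g : ℝ → S ⊕ E → ℝ := fun t => f (clamp a b (reflectRight y t)) with hg
  have hgc : Continuous g := hfc.continuous.comp (hclamp.comp (continuous_reflectRight hy))
  have hgi : ∀ i, Continuous fun t => g t i := fun i => (continuous_apply i).comp hgc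
  have hyi : ∀ i, Continuous fun t => y t i := fun i => (continuous_apply i).comp hy
  have hgC : ∀ i t, |g t i| ≤ (⟨C, hC0⟩ : NNReal) := fun i t =>
    (norm_le_pi_norm (g t) i).trans (hC _ (hcl _))
  have hy0 : y 0 = Sum.elim x₀ r₀ := by simpa using hyint 0 le_rfl
  have hyiint : ∀ i t, 0 ≤ t → y t i = y 0 i + ∫ s in (0 : ℝ)..t, g s i := by
    intro i t ht
    rw [hy0, hyint t ht, Pi.add_apply]
    congr 1
    exact ((ContinuousLinearMap.proj (R := ℝ)
      (φ := fun _ : S ⊕ E => ℝ) i).intervalIntegral_comp_comm (hgc.intervalIntegrable 0 t)).symm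
  have hlip := fun i => lipschitzOnWith_of_eq_integral (hgi i) (hgC i) (hyiint i)
  have hac : ∀ (w : ℝ → ℝ) (c : NNReal), LipschitzOnWith c w (Set.Ici 0) → ∀ b, 0 ≤ b →
      AbsolutelyContinuousOnInterval w 0 b := fun w c hw b hb =>
    (hw.mono (by rw [Set.uIcc_of_le hb]; exact fun u hu => hu.1)).absolutelyContinuousOnInterval
  refine ⟨fun t s => reflectRight y t (.inl s), fun t l => reflectRight y t (.inr l),
    ⟨fun t ht l => reflection_nonneg (hyi _) ht, fun b hb => ⟨fun s => hac _ _ (hlip _) b hb,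
      fun l => (hac _ _ (hlip (.inr l)) b hb).fun_add
        (hac _ _ (lipschitzOnWith_regulator (hyi _) (hlip (.inr l))) b hb)⟩, ?_⟩, ?_, ?_⟩
  · have hr : ∀ l : E, _ := fun l =>
      ae_hasDerivAt_reflection (hyi (.inr l)) (hgi (.inr l)) (hgC (.inr l)) (hyiint (.inr l))
    rw [ae_restrict_iff' measurableSet_Ici]
    filter_upwards [(ae_restrict_iff' measurableSet_Ici).1 (ae_all_iff.2 hr),
      (Set.countable_singleton (0 : ℝ)).ae_notMem volume] with t htr h0 ht0 hbox
    have ht : 0 < t := lt_of_le_of_ne ht0 (Ne.symm h0)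
    have hmem : reflectRight y t ∈ Set.Icc a b := by
      constructor
      · rintro (s | l)
        · exact hbox.1.1 s
        · exact hbox.1.2 l
      · rintro (s | l)
        · exact hbox.2.1 s
        · exact hbox.2.2 l
    have hgt : g t = f (reflectRight y t) := by rw [hg]; simp only [clamp_eq_self hmem]
    refine ⟨fun s => ?_, fun l => ?_⟩
    · refine (hasDerivAt_of_eq_integral (hgi (.inl s)) (hyiint (.inl s)) ht).congr_deriv ?_
      rw [rateField_eq route hk hT _ ((hm s).trans_le (hbox.1.1 s)), hgt]
      rfl
    · refine (htr ht0 l).congr_deriv ?_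
      rw [aggrField, proj, proj, hgt, mul_ite, mul_max_of_nonneg _ _ hα.le, mul_zero]
      rfl
  · funext s
    simp [reflectRight, hy0]
  · funext l
    have h1 : regulator (fun u => y u (.inr l)) 0 = 0 := by
      refine le_antisymm (regulator_le le_rfl le_rfl fun u hu => ?_) (regulator_nonneg (hyi _) 0)
      rw [le_antisymm hu.2 hu.1, hy0]
      exact neg_nonpos.2 (h₀.1.2 l)
    simp [reflectRight, h1, hy0]

lemma exists_isTrajectory (Gc : SimpleGraph E) (route : S → Finset E) {α β k : ℝ} (hα : 0 < α)
    (hβ : 0 < β) (hk : 0 < k) {T : S → ℝ} (hT : ∀ s, 0 < T s) {xs : S → ℝ} {rs : E → ℝ}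
    (heq : IsEquilibrium Gc route α β k T xs rs) {x₀ : S → ℝ} {r₀ : E → ℝ} (h₀ : IsState x₀ r₀) :
    ∃ x r, IsTrajectory Gc route α β k T x r ∧ x 0 = x₀ ∧ r 0 = r₀ := by
  obtain ⟨m, M, R, hm, hsub⟩ := exists_box hα hk hT rs heq.1.1
    (lyapunov_nonneg hα hk hT rs heq.1.1 (z := (x₀, r₀)) h₀.1)
  have hz := hsub (x₀, r₀) h₀.1 le_rfl
  obtain ⟨x, r, h, rfl, rfl⟩ := exists_solvesWithin Gc route (β := β) hα hk hT hm
    (x₀ := x₀) (r₀ := r₀)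
    ⟨⟨fun s => (hz.1 s).1.le, h₀.2⟩, ⟨fun s => (hz.1 s).2.le, fun l => (hz.2 l).le⟩⟩
  refine ⟨x, r, ⟨h₀, h.2.1, ?_⟩, rfl, rfl⟩
  rw [ae_restrict_iff' measurableSet_Ici]
  filter_upwards [(ae_restrict_iff' measurableSet_Ici).1 h.2.2] with t ht ht0
  exact ht ht0 (h.mem_box hα hβ hk hT heq hm h₀.1 hsub ht0)

end CSMA

theorem theorem2 {E S : Type*} [Fintype E] [DecidableEq E] [Fintype S]
    (Gc : SimpleGraph E) (route : S → Finset E) (hroute : ∀ s, (route s).Nonempty)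
    (α β k : ℝ) (hα : 0 < α) (hβ : 0 < β) (hk : 0 < k) (T : S → ℝ) (hT : ∀ s, 0 < T s) :
    (∀ (x : S → ℝ) (r : E → ℝ), CSMA.IsEquilibrium Gc route α β k T x r →
      CSMA.SolvesMP Gc route (2 * k ^ 2 * β) x (CSMA.gibbs Gc β r)) ∧
    ∃ (xs : S → ℝ) (τs : CSMA.Schedule Gc → ℝ),
      (CSMA.SolvesMP Gc route (2 * k ^ 2 * β) xs τs ∧
        ∀ x τ, CSMA.SolvesMP Gc route (2 * k ^ 2 * β) x τ → x = xs ∧ τ = τs) ∧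
      (∃ rs : E → ℝ, CSMA.IsEquilibrium Gc route α β k T xs rs ∧ CSMA.gibbs Gc β rs = τs ∧
        (∀ x r, CSMA.IsEquilibrium Gc route α β k T x r → x = xs ∧ r = rs) ∧
        CSMA.IsGloballyAsymptoticallyStable Gc route α β k T xs rs) ∧
      ∀ x r, CSMA.IsTrajectory Gc route α β k T x r →
        Tendsto x atTop (𝓝 xs) ∧ Tendsto (fun t => CSMA.gibbs Gc β (r t)) atTop (𝓝 τs) := by
  refine ⟨fun x r h => CSMA.solvesMP_of_isEquilibrium Gc route hα hβ hk hT h, ?_⟩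
  obtain ⟨xs, rs, heq⟩ := CSMA.exists_isEquilibrium Gc route hroute hα hβ hk hT
  refine ⟨xs, CSMA.gibbs Gc β rs, ⟨CSMA.solvesMP_of_isEquilibrium Gc route hα hβ hk hT heq,
    fun x τ h => CSMA.eq_of_solvesMP Gc route hα hβ hk hT heq h⟩,
    ⟨rs, heq, rfl, fun x r h => CSMA.isEquilibrium_unique Gc route hα hβ hk hT heq h,
      fun x₀ r₀ h₀ => CSMA.exists_isTrajectory Gc route hα hβ hk hT heq h₀,
      fun ε hε => CSMA.lyapunov_stable Gc route α β k T hα hβ hk hT heq hε,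
      fun x r h => h.tendsto hα hβ hk hT heq⟩, fun x r h => ?_⟩
  have := h.tendsto hα hβ hk hT heq
  exact ⟨(continuous_fst.tendsto _).comp this,
    (((CSMA.continuous_gibbs Gc β).comp continuous_snd).tendsto _).comp this⟩
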